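/- Let $\mathbb K$ be a field of characteristic $0$ and let $(\mathcal A,A,A')$ be a quasi-twilled associative algebra over $\mathbb K$, that is, an associative (not necessarily unital) algebra $\mathcal A$ with multiplication $\Omega$ and a decomposition into subspaces $\mathcal A=A\oplus A'$ such that $A'$ is a subalgebra. Write $\Omega=\pi+\xi+\eta+\beta+\rho+\mu+\theta$ for its components $\pi\in\mathrm{Hom}(A\otimes A,A)$, $\xi\in\mathrm{Hom}(A\otimes A',A)$, $\eta\in\mathrm{Hom}(A'\otimes A,A)$, $\beta\in\mathrm{Hom}(A'\otimes A',A')$, $\rho\in\mathrm{Hom}(A\otimes A',A')$, $\mu\in\mathrm{Hom}(A'\otimes A,A')$, $\theta\in\mathrm{Hom}(A\otimes A,A')$, where a multilinear map between copies of $A$ and $A'$ is regarded as a multilinear map on $\mathcal A$ by extending it by zero on the other tensor components. Let $L=\bigoplus_{n\ge 0}\mathrm{Hom}(\otimes^{n+1}\mathcal A,\mathcal A)$, with $\mathrm{Hom}(\otimes^{n+1}\mathcal A,\mathcal A)$ in degree $n$, equipped with the Gerstenhaber bracket: for $f\in\mathrm{Hom}(\otimes^{m}\mathcal A,\mathcal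 A)$ and $g\in\mathrm{Hom}(\otimes^{n}\mathcal A,\mathcal A)$, $$[f,g]_G=f\circ g-(-1)^{(m-1)(n-1)}g\circ f,\qquad f\circ g(x_1,\dots,x_{m+n-1})=\sum_{i=1}^{m}(-1)^{(i-1)(n-1)}f(x_1,\dots,x_{i-1},g(x_i,\dots,x_{i+n-1}),x_{i+n},\dots,x_{m+n-1}).$$ Let $F=\bigoplus_{n\ge 0}\mathrm{Hom}(\otimes^{n+1}A',A)\subseteq L$, let $P:L\to L$ be the projection onto $F$ along the other components, and let $\Delta=\Omega=\pi+\xi+\eta+\beta+\rho+\mu+\theta$. (1) $(L,F,P,\Delta)$ is a V-data: $(L,[\cdot,\cdot]_G)$ is a graded Lie algebra, $F$ is an abelian graded Lie subalgebra, $P\circ P=P$, the image of $P$ is $F$ and its kernel is a graded Lie subalgebra, $\Delta\in L^1$, $[\Delta,\Delta]_G=0$ and $P(\Delta)=0$. (2) Consequently, the operations $l_0=P(\Delta)$ and $l_k(f_1,\dots,f_k)=P[\cdots[[\Delta,f_1]_G,f_2]_G,\cdots,f_k]_G$ $(k\ge 1)$ make $F$ an $L_\infty$-algebra: $l_0=0$,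 every $l_k$ is multilinear of degree $1$ and graded symmetric, and for all $n\ge 0$ and homogeneous $x_1,\dots,x_n\in F$ $$\sum_{i=0}^{n}\ \sum_{\sigma\in S(i,n-i)}\varepsilon(\sigma)\,l_{n-i+1}(l_i(x_{\sigma(1)},\dots,x_{\sigma(i)}),x_{\sigma(i+1)},\dots,x_{\sigma(n)})=0,$$ where $S(i,n-i)$ is the set of $(i,n-i)$-shuffles and $\varepsilon(\sigma)$ is the Koszul sign. Moreover, for all $f,f_1,f_2,f_3\in F$, $$l_1(f)=[\xi+\eta+\beta,f]_G,\qquad l_2(f_1,f_2)=[[\pi+\rho+\mu,f_1]_G,f_2]_G,\qquad l_3(f_1,f_2,f_3)=[[[\theta,f_1]_G,f_2]_G,f_3]_G,$$ and $l_k=0$ for all $k\ge 4$. (3) A linear map $B:A'\to A$ is a left deformation map of $(\mathcal A,A,A')$, that is, $$\pi(B(u),B(v))+\xi(B(u),v)+\eta(u,B(v))=B\big(\beta(u,v)+\rho(B(u),v)+\mu(u,B(v))+\theta(B(u),B(v))\big)\qquad\text{for all }u,v\in A',$$ if and only if $B$ is a Maurer--Cartan element of this $L_\infty$-algebra, that is,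 an element of degree $0$ of $F$ with $\sum_{k\ge 1}\frac{1}{k!}\,l_k(B,\dots,B)=0$. -/

import Mathlib

open scoped DirectSum

/-! ### Graded Lie algebras -/

/-- `(L, [·,·])` is a graded Lie algebra with respect to the `ℤ`-grading `𝓖`. -/
structure IsGradedLieAlgebra {K L : Type*} [Field K] [AddCommGroup L] [Module K L]
    (𝓖 : ℤ → Submodule K L) (br : L →ₗ[K] L →ₗ[K] L) : Prop where
  isInternal : DirectSum.IsInternal 𝓖
  bracket_mem : ∀ (a b : ℤ) (x y : L), x ∈ 𝓖 a → y ∈ 𝓖 b → br x y ∈ 𝓖 (a + b)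
  antisymm : ∀ (a b : ℤ) (x y : L), x ∈ 𝓖 a → y ∈ 𝓖 b →
    br x y = -((a * b).negOnePow • br y x)
  jacobi : ∀ (a b c : ℤ) (x y z : L), x ∈ 𝓖 a → y ∈ 𝓖 b → z ∈ 𝓖 c →
    br x (br y z) = br (br x y) z + (a * b).negOnePow • br y (br x z)

/-- A graded Lie subalgebra: a subspace spanned by its homogeneous elements and closed under
the bracket. -/
structure IsGradedLieSubalgebra {K L : Type*} [Field K] [AddCommGroup L] [Module K L]
    (𝓖 : ℤ → Submodule K L) (br : L →ₗ[K] L →ₗ[K] L) (S : Submodule K L) : Prop where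
  homogeneous : S = ⨆ k : ℤ, S ⊓ 𝓖 k
  bracket_mem : ∀ x ∈ S, ∀ y ∈ S, br x y ∈ S

/-! ### Curved `L∞`-algebras and Maurer-Cartan elements -/

/-- The Koszul sign `ε(σ; x₁, …, xₙ)` for homogeneous elements of degrees `d`. -/
def koszulSign {n : ℕ} (d : Fin n → ℤ) (σ : Equiv.Perm (Fin n)) : ℤˣ :=
  ∏ p : Fin n × Fin n,
    if p.1 < p.2 ∧ σ p.2 < σ p.1 then (d (σ p.1) * d (σ p.2)).negOnePow else 1

/-- `σ` is an `(i, n-i)`-shuffle: it is increasing on the first `i` and on the last `n-i`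
positions. -/
def IsShuffle {n : ℕ} (i : ℕ) (σ : Equiv.Perm (Fin n)) : Prop :=
  ∀ a b : Fin n, a < b → ((b : ℕ) < i ∨ i ≤ (a : ℕ)) → σ a < σ b

open Classical in
/-- The set `S(i, n-i)` of `(i, n-i)`-shuffles. -/
noncomputable def shuffles (n i : ℕ) : Finset (Equiv.Perm (Fin n)) :=
  Finset.univ.filter fun σ => IsShuffle i σ

/-- `(V, {l_k}_{k ≥ 0})` is a curved `L∞`-algebra (with graded symmetric operations of
degree `1`) with respect to the `ℤ`-grading `𝓖`. -/
structure IsCurvedLInfinity {K V : Type*} [Field K] [AddCommGroup V] [Module K V]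
    (𝓖 : ℤ → Submodule K V) (l : (k : ℕ) → MultilinearMap K (fun _ : Fin k => V) V) :
    Prop where
  isInternal : DirectSum.IsInternal 𝓖
  degree_one : ∀ (n : ℕ) (d : Fin n → ℤ) (x : Fin n → V), (∀ a, x a ∈ 𝓖 (d a)) →
    l n x ∈ 𝓖 ((∑ a, d a) + 1)
  graded_symm : ∀ (n : ℕ) (d : Fin n → ℤ) (x : Fin n → V), (∀ a, x a ∈ 𝓖 (d a)) →
    ∀ σ : Equiv.Perm (Fin n), l n (fun a => x (σ a)) = koszulSign d σ • l n x
  jacobi : ∀ (n : ℕ) (d : Fin n → ℤ) (x : Fin n → V), (∀ a, x a ∈ 𝓖 (d a)) →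
    ∑ i : Fin (n + 1), ∑ σ ∈ shuffles n i,
      koszulSign d σ •
        l (n - i + 1) (Fin.cons
          (l i fun a : Fin i => x (σ ⟨a, by omega⟩))
          (fun b : Fin (n - i) => x (σ ⟨i + b, by omega⟩))) = 0

/-- An `L∞`-algebra is a curved `L∞`-algebra with `l₀ = 0`. -/
structure IsLInfinity {K V : Type*} [Field K] [AddCommGroup V] [Module K V]
    (𝓖 : ℤ → Submodule K V) (l : (k : ℕ) → MultilinearMap K (fun _ : Fin k => V) V) : Prop
    extends IsCurvedLInfinity 𝓖 l where
  curvature_eq_zero : l 0 = 0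

/-- A Maurer-Cartan element of `(V, {l_k})`: a degree `0` element `x` for which
`l₀ + ∑_{k ≥ 1} (1/k!) l_k(x, …, x)` is a finite sum and vanishes. -/
structure IsMaurerCartan {K V : Type*} [Field K] [AddCommGroup V] [Module K V]
    (𝓖 : ℤ → Submodule K V) (l : (k : ℕ) → MultilinearMap K (fun _ : Fin k => V) V)
    (x : V) : Prop where
  degree_zero : x ∈ 𝓖 0
  finite : {k : ℕ | (k.factorial : K)⁻¹ • l k (fun _ => x) ≠ 0}.Finite
  equation : ∑ᶠ k : ℕ, (k.factorial : K)⁻¹ • l k (fun _ => x) = 0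

/-! ### V-data and derived brackets -/

/-- `(L, F, P, Δ)` is a curved V-data, where `L` is graded by `𝓖` and has bracket `br`. -/
structure IsCurvedVData {K L : Type*} [Field K] [AddCommGroup L] [Module K L]
    (𝓖 : ℤ → Submodule K L) (br : L →ₗ[K] L →ₗ[K] L) (F : Submodule K L)
    (P : L →ₗ[K] L) (Δ : L) : Prop where
  gradedLie : IsGradedLieAlgebra 𝓖 br
  subalgebra : IsGradedLieSubalgebra 𝓖 br F
  abelian : ∀ x ∈ F, ∀ y ∈ F, br x y = 0
  proj : P ∘ₗ P = P
  range_proj : LinearMap.range P = F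
  ker_proj : IsGradedLieSubalgebra 𝓖 br (LinearMap.ker P)
  degree_one : Δ ∈ 𝓖 1
  square_zero : br Δ Δ = 0

/-- A V-data is a curved V-data with `Δ ∈ ker P`. -/
structure IsVData {K L : Type*} [Field K] [AddCommGroup L] [Module K L]
    (𝓖 : ℤ → Submodule K L) (br : L →ₗ[K] L →ₗ[K] L) (F : Submodule K L)
    (P : L →ₗ[K] L) (Δ : L) : Prop extends IsCurvedVData 𝓖 br F P Δ where
  mem_ker : P Δ = 0

/-- The multilinear map `(x₁, …, x_k) ↦ [⋯[[Δ, x₁], x₂], ⋯, x_k]`. -/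
noncomputable def iteratedBracket {K L : Type*} [Field K] [AddCommGroup L] [Module K L]
    (br : L →ₗ[K] L →ₗ[K] L) (Δ : L) :
    (k : ℕ) → MultilinearMap K (fun _ : Fin k => L) L
  | 0 => MultilinearMap.constOfIsEmpty K _ Δ
  | k + 1 =>
      MultilinearMap.uncurryRight (M := fun _ : Fin (k + 1) => L)
        (br.compMultilinearMap (iteratedBracket br Δ k))

/-- The higher derived brackets `l_k(x₁, …, x_k) = P [⋯[[Δ, x₁], x₂], ⋯, x_k]` on `F`. -/
noncomputable def derivedBracket {K L : Type*} [Field K] [AddCommGroup L] [Module K L]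
    (br : L →ₗ[K] L →ₗ[K] L) (F : Submodule K L) (P : L →ₗ[K] L) (hP : ∀ x, P x ∈ F)
    (Δ : L) (k : ℕ) : MultilinearMap K (fun _ : Fin k => F) F :=
  (P.codRestrict F hP).compMultilinearMap
    ((iteratedBracket br Δ k).compLinearMap fun _ => F.subtype)

/-- The grading that a grading of `L` induces on a subspace `F`. -/
def inducedGrading {K L : Type*} [Field K] [AddCommGroup L] [Module K L]
    (𝓖 : ℤ → Submodule K L) (F : Submodule K L) (k : ℤ) : Submodule K F :=
  (𝓖 k).comap F.subtype

/-! ### Cochains and the Gerstenhaber bracket -/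

/-- `Hom(⊗^{n+1} V, W)`, the cochains of degree `n`. -/
abbrev Cochain (K V W : Type*) [Field K] [AddCommGroup V] [Module K V] [AddCommGroup W]
    [Module K W] (n : ℕ) : Type _ :=
  MultilinearMap K (fun _ : Fin (n + 1) => V) W

/-- The space `⊕_{n ≥ 0} Hom(⊗^{n+1} V, W)`. -/
def CochainSum (K V W : Type*) [Field K] [AddCommGroup V] [Module K V] [AddCommGroup W]
    [Module K W] : Type _ :=
  ⨁ n : ℕ, Cochain K V W n

namespace CochainSum

variable {K V W : Type*} [Field K] [AddCommGroup V] [Module K V] [AddCommGroup W] [Module K W]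

noncomputable instance : AddCommGroup (CochainSum K V W) :=
  inferInstanceAs (AddCommGroup (⨁ n : ℕ, Cochain K V W n))

noncomputable instance : Module K (CochainSum K V W) :=
  inferInstanceAs (Module K (⨁ n : ℕ, Cochain K V W n))

/-- The inclusion of `Hom(⊗^{n+1} V, W)` into the direct sum. -/
noncomputable def of (n : ℕ) : Cochain K V W n →ₗ[K] CochainSum K V W :=
  DirectSum.lof K ℕ (Cochain K V W) n

/-- The linear map on the direct sum that is `φ n` on `Hom(⊗^{n+1} V, W)`. -/
noncomputable def desc {M : Type*} [AddCommGroup M] [Module K M]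
    (φ : (n : ℕ) → Cochain K V W n →ₗ[K] M) : CochainSum K V W →ₗ[K] M :=
  DirectSum.toModule K ℕ M φ

theorem desc_of {M : Type*} [AddCommGroup M] [Module K M]
    (φ : (n : ℕ) → Cochain K V W n →ₗ[K] M) (n : ℕ) (f : Cochain K V W n) :
    desc φ (of n f) = φ n f :=
  DirectSum.toModule_lof K n f

theorem hom_ext {M : Type*} [AddCommGroup M] [Module K M] {φ ψ : CochainSum K V W →ₗ[K] M}
    (h : ∀ (n : ℕ) (f : Cochain K V W n), φ (of n f) = ψ (of n f)) : φ = ψ :=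
  DirectSum.linearMap_ext K fun n => LinearMap.ext (h n)

end CochainSum

/-- The `ℤ`-grading of `⊕_{n ≥ 0} Hom(⊗^{n+1} V, W)` by degree; it is zero in negative
degrees. -/
noncomputable def cochainGrading (K V W : Type*) [Field K] [AddCommGroup V] [Module K V] [AddCommGroup W]
    [Module K W] : ℤ → Submodule K (CochainSum K V W)
  | Int.ofNat n => LinearMap.range (CochainSum.of n)
  | Int.negSucc _ => ⊥

/-- The arguments `(x₀, …, x_{i-1}, v, x_{i+n+1}, …, x_{m+n})` (numbering from `0`). -/
def insertArgs {V : Type*} {m n : ℕ} (i : Fin (m + 1)) (x : Fin (m + n + 1) → V) (v : V) :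
    Fin (m + 1) → V := fun j =>
  if j < i then x ⟨j, by omega⟩ else if j = i then v else x ⟨j + n, by omega⟩

/-- The arguments `(x_i, …, x_{i+n})`. -/
def blockArgs {V : Type*} {m n : ℕ} (i : Fin (m + 1)) (x : Fin (m + n + 1) → V) : Fin (n + 1) → V :=
  fun k => x ⟨i + k, by omega⟩


theorem insertArgs_update_value {V : Type*} {m n : ℕ} (i : Fin (m + 1)) (x : Fin (m + n + 1) → V)
    (v w : V) : insertArgs i x v = Function.update (insertArgs i x w) i v := by
  funext j
  by_cases h : j = i
  · subst h
    simp [insertArgs]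
  · simp [insertArgs, h]

section Gerstenhaber

variable {K V : Type*} [Field K] [AddCommGroup V] [Module K V]

theorem exists_insertArgs_update {m n : ℕ} (i : Fin (m + 1)) (g : Cochain K V V n)
    (x : Fin (m + n + 1) → V) (k : Fin (m + n + 1)) :
    ∃ (j : Fin (m + 1)) (φ : V →ₗ[K] V), ∀ a : V,
      insertArgs i (Function.update x k a) (g (blockArgs i (Function.update x k a))) =
        Function.update (insertArgs i x (g (blockArgs i x))) j (φ a) := by
  by_cases h₁ : (k : ℕ) < i
  · refine ⟨⟨k, by omega⟩, LinearMap.id, fun a => ?_⟩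
    have hb : blockArgs i (Function.update x k a) = blockArgs i x := by
      funext t
      refine Function.update_of_ne ?_ _ _
      simp only [ne_eq, Fin.ext_iff]
      omega
    rw [hb]
    funext j
    simp only [insertArgs, Function.update_apply, Fin.ext_iff, Fin.lt_def, LinearMap.id_apply]
    split_ifs <;> first | rfl | omega
  by_cases h₂ : (k : ℕ) ≤ i + n
  · refine ⟨i, g.toLinearMap (blockArgs i x) ⟨k - i, by omega⟩, fun a => ?_⟩
    have hb : blockArgs i (Function.update x k a) =
        Function.update (blockArgs i x) ⟨k - i, by omega⟩ a := by
      funext t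
      simp only [blockArgs, Function.update_apply, Fin.ext_iff]
      split_ifs <;> first | rfl | omega
    rw [hb]
    funext j
    simp only [insertArgs, Function.update_apply, Fin.ext_iff, Fin.lt_def,
      MultilinearMap.toLinearMap_apply]
    split_ifs <;> first | rfl | omega
  · refine ⟨⟨k - n, by omega⟩, LinearMap.id, fun a => ?_⟩
    have hb : blockArgs i (Function.update x k a) = blockArgs i x := by
      funext t
      refine Function.update_of_ne ?_ _ _
      simp only [ne_eq, Fin.ext_iff]
      omega
    rw [hb]
    funext j
    simp only [insertArgs, Function.update_apply, Fin.ext_iff, Fin.lt_def, LinearMap.id_apply]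
    split_ifs <;> first | rfl | omega

/-- The partial composition
`(x₀, …, x_{m+n}) ↦ f(x₀, …, x_{i-1}, g(x_i, …, x_{i+n}), x_{i+n+1}, …, x_{m+n})`. -/
def partialComp {m n : ℕ} (i : Fin (m + 1)) (f : Cochain K V V m) (g : Cochain K V V n) :
    Cochain K V V (m + n) :=
  MultilinearMap.mk' (fun x => f (insertArgs i x (g (blockArgs i x))))
    (fun x k a b => by
      obtain ⟨j, φ, h⟩ := exists_insertArgs_update i g x k
      rw [h, h, h, map_add, MultilinearMap.map_update_add])
    (fun x k c a => by
      obtain ⟨j, φ, h⟩ := exists_insertArgs_update i g x k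
      rw [h, h, map_smul, MultilinearMap.map_update_smul])

theorem partialComp_apply {m n : ℕ} (i : Fin (m + 1)) (f : Cochain K V V m)
    (g : Cochain K V V n) (x : Fin (m + n + 1) → V) :
    partialComp i f g x = f (insertArgs i x (g (blockArgs i x))) := rfl

/-- The partial composition as a bilinear map. -/
def partialCompₗ {m n : ℕ} (i : Fin (m + 1)) :
    Cochain K V V m →ₗ[K] Cochain K V V n →ₗ[K] Cochain K V V (m + n) :=
  LinearMap.mk₂ K (partialComp i)
    (fun _ _ _ => MultilinearMap.ext fun _ => rfl)
    (fun _ _ _ => MultilinearMap.ext fun _ => rfl)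
    (fun f g g' => MultilinearMap.ext fun x => by
      simp only [add_apply, partialComp_apply]
      rw [insertArgs_update_value i x (_ + _) 0, MultilinearMap.map_update_add,
        ← insertArgs_update_value, ← insertArgs_update_value])
    (fun c f g => MultilinearMap.ext fun x => by
      simp only [smul_apply, partialComp_apply]
      rw [insertArgs_update_value i x (_ • _) 0, MultilinearMap.map_update_smul,
        ← insertArgs_update_value])

/-- The circle product `f ∘ g = ∑ᵢ (-1)^{i n} f(x₀, …, g(x_i, …, x_{i+n}), …, x_{m+n})` of
cochains of degrees `m` and `n` (arguments numbered from `0`). -/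
def circ (m n : ℕ) : Cochain K V V m →ₗ[K] Cochain K V V n →ₗ[K] Cochain K V V (m + n) :=
  ∑ i : Fin (m + 1), (-1 : K) ^ ((i : ℕ) * n) • partialCompₗ i

/-- The Gerstenhaber bracket `[f, g] = f ∘ g - (-1)^{m n} g ∘ f` of cochains of degrees `m`
and `n`, as an element of the direct sum. -/
noncomputable def homogeneousBracket (m n : ℕ) :
    Cochain K V V m →ₗ[K] Cochain K V V n →ₗ[K] CochainSum K V V :=
  (circ m n).compr₂ (CochainSum.of (m + n)) -
    (-1 : K) ^ (m * n) • (circ n m).flip.compr₂ (CochainSum.of (n + m))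

/-- The Gerstenhaber bracket on `⊕_{n ≥ 0} Hom(⊗^{n+1} V, V)`. -/
noncomputable def gerstenhaberBracket (K V : Type*) [Field K] [AddCommGroup V] [Module K V] :
    CochainSum K V V →ₗ[K] CochainSum K V V →ₗ[K] CochainSum K V V :=
  CochainSum.desc fun m => (CochainSum.desc fun n => (homogeneousBracket m n).flip).flip

/-- A bilinear map as an element of `Hom(V ⊗ V, V)`, in degree `1`. -/
noncomputable def bilinCochain (f : V →ₗ[K] V →ₗ[K] V) : CochainSum K V V :=
  CochainSum.of 1
    (MultilinearMap.mk' (fun x => f (x 0) (x 1))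
      (fun x k a b => by fin_cases k <;> simp)
      (fun x k c a => by fin_cases k <;> simp))

end Gerstenhaber

/-! ### Quasi-twilled associative algebras -/

/-- A quasi-twilled associative algebra `(𝒜, A, A')`: an associative (not necessarily unital)
algebra with a decomposition `𝒜 = A ⊕ A'` into subspaces such that `A'` is a subalgebra. -/
structure QuasiTwilledAlgebra (K 𝒜 : Type*) [Field K] [NonUnitalRing 𝒜] [Module K 𝒜]
    [IsScalarTower K 𝒜 𝒜] [SMulCommClass K 𝒜 𝒜] where
  A : Submodule K 𝒜
  A' : Submodule K 𝒜
  isCompl : IsCompl A A'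
  mul_mem : ∀ u ∈ A', ∀ v ∈ A', u * v ∈ A'

namespace QuasiTwilledAlgebra

variable {K 𝒜 : Type*} [Field K] [NonUnitalRing 𝒜] [Module K 𝒜]
  [IsScalarTower K 𝒜 𝒜] [SMulCommClass K 𝒜 𝒜] (T : QuasiTwilledAlgebra K 𝒜)

/-- The projection of `𝒜 = A ⊕ A'` onto `A`. -/
noncomputable def projA : 𝒜 →ₗ[K] T.A := T.A.projectionOnto T.A' T.isCompl

/-- The projection of `𝒜 = A ⊕ A'` onto `A'`. -/
noncomputable def projA' : 𝒜 →ₗ[K] T.A' := T.A'.projectionOnto T.A T.isCompl.symm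

/-- The `A`-component of the product of `x ∈ A` and `y ∈ A`. -/
noncomputable def π : T.A →ₗ[K] T.A →ₗ[K] T.A :=
  ((LinearMap.mul K 𝒜).compl₁₂ T.A.subtype T.A.subtype).compr₂ T.projA

/-- The `A`-component of the product of `x ∈ A` and `v ∈ A'`. -/
noncomputable def ξ : T.A →ₗ[K] T.A' →ₗ[K] T.A :=
  ((LinearMap.mul K 𝒜).compl₁₂ T.A.subtype T.A'.subtype).compr₂ T.projA

/-- The `A`-component of the product of `u ∈ A'` and `y ∈ A`. -/
noncomputable def η : T.A' →ₗ[K] T.A →ₗ[K] T.A :=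
  ((LinearMap.mul K 𝒜).compl₁₂ T.A'.subtype T.A.subtype).compr₂ T.projA

/-- The `A'`-component of the product of `u ∈ A'` and `v ∈ A'`. -/
noncomputable def β : T.A' →ₗ[K] T.A' →ₗ[K] T.A' :=
  ((LinearMap.mul K 𝒜).compl₁₂ T.A'.subtype T.A'.subtype).compr₂ T.projA'

/-- The `A'`-component of the product of `x ∈ A` and `v ∈ A'`. -/
noncomputable def ρ : T.A →ₗ[K] T.A' →ₗ[K] T.A' :=
  ((LinearMap.mul K 𝒜).compl₁₂ T.A.subtype T.A'.subtype).compr₂ T.projA'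

/-- The `A'`-component of the product of `u ∈ A'` and `y ∈ A`. -/
noncomputable def μ : T.A' →ₗ[K] T.A →ₗ[K] T.A' :=
  ((LinearMap.mul K 𝒜).compl₁₂ T.A'.subtype T.A.subtype).compr₂ T.projA'

/-- The `A'`-component of the product of `x ∈ A` and `y ∈ A`. -/
noncomputable def θ : T.A →ₗ[K] T.A →ₗ[K] T.A' :=
  ((LinearMap.mul K 𝒜).compl₁₂ T.A.subtype T.A.subtype).compr₂ T.projA'

/-- The graded vector space `L = ⊕_{n ≥ 0} Hom(⊗^{n+1} 𝒜, 𝒜)`. -/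
abbrev L (_T : QuasiTwilledAlgebra K 𝒜) : Type _ := CochainSum K 𝒜 𝒜

/-- The multiplication `Ω` of `𝒜`, as an element of `L`. -/
noncomputable def Ω : T.L := bilinCochain (LinearMap.mul K 𝒜)

/-- The lift of `π` to an element of `L`; similarly for the other components. -/
noncomputable def πL : T.L :=
  bilinCochain ((T.π.compl₁₂ T.projA T.projA).compr₂ T.A.subtype)

noncomputable def ξL : T.L :=
  bilinCochain ((T.ξ.compl₁₂ T.projA T.projA').compr₂ T.A.subtype)

noncomputable def ηL : T.L :=
  bilinCochain ((T.η.compl₁₂ T.projA' T.projA).compr₂ T.A.subtype)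

noncomputable def βL : T.L :=
  bilinCochain ((T.β.compl₁₂ T.projA' T.projA').compr₂ T.A'.subtype)

noncomputable def ρL : T.L :=
  bilinCochain ((T.ρ.compl₁₂ T.projA T.projA').compr₂ T.A'.subtype)

noncomputable def μL : T.L :=
  bilinCochain ((T.μ.compl₁₂ T.projA' T.projA).compr₂ T.A'.subtype)

noncomputable def θL : T.L :=
  bilinCochain ((T.θ.compl₁₂ T.projA T.projA).compr₂ T.A'.subtype)

/-- The lift of `f ∈ Hom(⊗^{n+1} A', A)` to `Hom(⊗^{n+1} 𝒜, 𝒜)`: it is `f` on `⊗^{n+1} A'`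
and vanishes when some argument is in `A`. -/
noncomputable def lift (n : ℕ) : Cochain K T.A' T.A n →ₗ[K] Cochain K 𝒜 𝒜 n where
  toFun f := T.A.subtype.compMultilinearMap (f.compLinearMap fun _ => T.projA')
  map_add' _ _ := rfl
  map_smul' _ _ := rfl

/-- The `Hom(⊗^{n+1} A', A)`-component of an element of `Hom(⊗^{n+1} 𝒜, 𝒜)`. -/
noncomputable def component (n : ℕ) : Cochain K 𝒜 𝒜 n →ₗ[K] Cochain K T.A' T.A n where
  toFun f := T.projA.compMultilinearMap (f.compLinearMap fun _ => T.A'.subtype)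
  map_add' _ _ := MultilinearMap.ext fun _ => map_add T.projA _ _
  map_smul' _ _ := MultilinearMap.ext fun _ => map_smul T.projA _ _

/-- The lift `⊕_{n ≥ 0} Hom(⊗^{n+1} A', A) → L`. -/
noncomputable def liftSum : CochainSum K T.A' T.A →ₗ[K] T.L :=
  CochainSum.desc fun n => CochainSum.of n ∘ₗ T.lift n

/-- The map `L → ⊕_{n ≥ 0} Hom(⊗^{n+1} A', A)` that takes components. -/
noncomputable def componentSum : T.L →ₗ[K] CochainSum K T.A' T.A :=
  CochainSum.desc fun n => CochainSum.of n ∘ₗ T.component n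

theorem componentSum_liftSum (f : CochainSum K T.A' T.A) :
    T.componentSum (T.liftSum f) = f := by
  have h : T.componentSum ∘ₗ T.liftSum = LinearMap.id := by
    refine CochainSum.hom_ext fun n f => ?_
    simp only [componentSum, liftSum, LinearMap.comp_apply, CochainSum.desc_of,
      LinearMap.id_apply]
    congr 1
    refine MultilinearMap.ext fun u => ?_
    simp [component, lift, projA, projA']
  exact LinearMap.congr_fun h f

/-- `F = ⊕_{n ≥ 0} Hom(⊗^{n+1} A', A)` as a subspace of `L`. -/
noncomputable def F : Submodule K T.L := LinearMap.range T.liftSum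

/-- The identification of `⊕_{n ≥ 0} Hom(⊗^{n+1} A', A)` with the subspace `F` of `L`. -/
noncomputable def toF : CochainSum K T.A' T.A ≃ₗ[K] T.F :=
  LinearEquiv.ofInjective T.liftSum (Function.LeftInverse.injective T.componentSum_liftSum)

/-- The projection `P : L → L` onto `F`, along the other components of `L`. -/
noncomputable def P : T.L →ₗ[K] T.L := T.liftSum ∘ₗ T.componentSum

theorem P_mem (f : T.L) : T.P f ∈ T.F := ⟨T.componentSum f, rfl⟩

/-- The grading of `L`, and the one it induces on `F`. -/
noncomputable def gradingL : ℤ → Submodule K T.L := cochainGrading K 𝒜 𝒜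

noncomputable def gradingF : ℤ → Submodule K T.F := inducedGrading T.gradingL T.F

/-- The Gerstenhaber bracket of `L`. -/
noncomputable def bracket : T.L →ₗ[K] T.L →ₗ[K] T.L := gerstenhaberBracket K 𝒜

/-- The operations `l_k(f₁, …, f_k) = P [⋯[[Ω, f₁], f₂], ⋯, f_k]` on `F`. -/
noncomputable def l (k : ℕ) : MultilinearMap K (fun _ : Fin k => T.F) T.F :=
  derivedBracket T.bracket T.F T.P T.P_mem T.Ω k

/-- A left deformation map of `(𝒜, A, A')`. -/
def IsLeftDeformationMap (B : T.A' →ₗ[K] T.A) : Prop :=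
  ∀ u v : T.A',
    T.π (B u) (B v) + T.ξ (B u) v + T.η u (B v) =
      B (T.β u v + T.ρ (B u) v + T.μ u (B v) + T.θ (B u) (B v))

/-- A linear map `B : A' → A` as an element of `F`, in `Hom(⊗^1 A', A)`. -/
noncomputable def ofMap (B : T.A' →ₗ[K] T.A) : T.F :=
  T.toF (CochainSum.of 0
    (MultilinearMap.ofSubsingleton K T.A' T.A (0 : Fin 1) B))

end QuasiTwilledAlgebra

/-! The L∞ part is Voronov's derived bracket argument, valid in characteristic 0 for every curved
V-data whose projection P preserves degrees. Write Δ_S for the iterated bracket of Δ with the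
entries x_k, k ∈ S. The Leibniz rule (`subsetBracket_univ_bracket`) expands 0 = [⋯[[Δ,Δ],x₁],⋯,x_n]
into signed brackets [Δ_S, Δ_{Sᶜ}]. As ker P is a subalgebra and F is abelian, P[u,v] = P[Pu,v] +
P[u,Pv]; and PΔ_S commutes with all x_k, so it can be moved next to Δ. Hence S contributes the
Jacobi terms of S and of Sᶜ, and summing over S gives twice the Jacobi expression
(`sum_powerset_proj_eq_zero`). Shuffles correspond to subsets (`sum_shuffles`). Graded symmetry
holds because the entries commute (`iteratedBracket_perm`).

The Gerstenhaber bracket is a graded Lie bracket because the associator of the circle product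
consists of the disjoint insertions, which are graded symmetric (`evalSeq_circ_circ`,
`circSum_preLie`). F is abelian because its elements take values in A and vanish on A. The kernel of
P consists of the cochains mapping tensors of A' into A', a condition stable under composition and
satisfied by Ω since A' is a subalgebra. Associativity gives [Ω,Ω] = 0.

The formulas for l_k come from a weight grading, the eigenspaces of bracketing with the projection e
of 𝒜 onto A. Brackets add weights; ξ, η, β have weight 0, π, ρ, μ have weight -1, θ has weight -2,
and F is exactly the weight 1 space. So k brackets with F shift the weight by k, and P keeps only
weight 1: each l_k with k = 1, 2, 3 sees one group of components, and for k ≥ 4 nothing survives.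

For the Maurer-Cartan equation, B is an endomorphism t of 𝒜 with t² = 0, and the sum of the iterated
brackets divided by k! is (1-t)((1+t)x · (1+t)y) - xy. Its A-component on A' is the equation of a
left deformation map. -/

theorem map_intUnits_smul {M N : Type*} [AddCommGroup M] [AddCommGroup N] {G : Type*}
    [FunLike G M N] [AddMonoidHomClass G M N] (φ : G) (u : ℤˣ) (x : M) :
    φ (u • x) = u • φ x := by
  rw [Units.smul_def, Units.smul_def, map_zsmul]

theorem neg_intUnits_smul {M : Type*} [AddCommGroup M] (u : ℤˣ) (x : M) :
    -(u • x) = (-u) • x := by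
  rw [Units.smul_def, Units.smul_def, Units.val_neg, neg_smul]

/-! ### Koszul signs of splitting a sequence along a subset -/

section Signs

open Classical in
/-- The sum of the degrees `d k` for `k < n` in `s`. -/
noncomputable def degreeSum (d : ℕ → ℤ) (s : Set ℕ) (n : ℕ) : ℤ :=
  ∑ k ∈ Finset.range n, if k ∈ s then d k else 0

open Classical in
/-- The Koszul sign of moving the elements with index in `s` in front of the others. -/
noncomputable def unshuffleSign (d : ℕ → ℤ) (s : Set ℕ) (n : ℕ) : ℤˣ :=
  ∏ a ∈ Finset.range n, ∏ b ∈ Finset.range a,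
    if a ∈ s ∧ b ∉ s then (d a * d b).negOnePow else 1

theorem degreeSum_succ_of_mem (d : ℕ → ℤ) {s : Set ℕ} {n : ℕ} (h : n ∈ s) :
    degreeSum d s (n + 1) = degreeSum d s n + d n := by
  simp [degreeSum, Finset.sum_range_succ, h]

theorem degreeSum_succ_of_notMem (d : ℕ → ℤ) {s : Set ℕ} {n : ℕ} (h : n ∉ s) :
    degreeSum d s (n + 1) = degreeSum d s n := by
  simp [degreeSum, Finset.sum_range_succ, h]

theorem degreeSum_congr (d : ℕ → ℤ) {s t : Set ℕ} {n : ℕ} (h : ∀ k < n, k ∈ s ↔ k ∈ t) :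
    degreeSum d s n = degreeSum d t n :=
  Finset.sum_congr rfl fun k hk => by
    classical exact if_congr (h k (Finset.mem_range.mp hk)) rfl rfl

theorem unshuffleSign_succ_of_notMem (d : ℕ → ℤ) {s : Set ℕ} {n : ℕ} (h : n ∉ s) :
    unshuffleSign d s (n + 1) = unshuffleSign d s n := by
  simp [unshuffleSign, Finset.prod_range_succ, h]

theorem unshuffleSign_succ_of_mem (d : ℕ → ℤ) {s : Set ℕ} {n : ℕ} (h : n ∈ s) :
    unshuffleSign d s (n + 1) =
      unshuffleSign d s n * (d n * degreeSum d sᶜ n).negOnePow := by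
  classical
  have key : ∀ m : ℕ, (∏ b ∈ Finset.range m, if b ∉ s then (d n * d b).negOnePow else 1) =
      (d n * degreeSum d sᶜ m).negOnePow := by
    intro m
    induction m with
    | zero => simp [degreeSum]
    | succ m ih =>
      rw [Finset.prod_range_succ, ih]
      by_cases hm : m ∈ s
      · rw [degreeSum_succ_of_notMem d (s := sᶜ) (by simpa using hm)]
        simp [hm]
      · rw [degreeSum_succ_of_mem d (s := sᶜ) hm, mul_add, Int.negOnePow_add]
        simp [hm]
  rw [← key n]
  simp [unshuffleSign, Finset.prod_range_succ, h]

theorem unshuffleSign_congr (d : ℕ → ℤ) {s t : Set ℕ} {n : ℕ} (h : ∀ k < n, k ∈ s ↔ k ∈ t) :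
    unshuffleSign d s n = unshuffleSign d t n := by
  refine Finset.prod_congr rfl fun a ha => Finset.prod_congr rfl fun b hb => ?_
  rw [Finset.mem_range] at ha hb
  classical exact if_congr (and_congr (h a ha) (not_congr (h b (hb.trans ha)))) rfl rfl

/-- A pair with one index in `s` and the other outside is reversed by exactly one of the two
rearrangements, so the two signs differ by the product over all such pairs. -/
theorem unshuffleSign_compl (d : ℕ → ℤ) (s : Set ℕ) (n : ℕ) :
    unshuffleSign d sᶜ n =
      unshuffleSign d s n * (degreeSum d s n * degreeSum d sᶜ n).negOnePow := by
  induction n with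
  | zero => simp [unshuffleSign, degreeSum]
  | succ n ih =>
    by_cases h : n ∈ s
    · have h' : n ∉ sᶜ := by simpa using h
      rw [unshuffleSign_succ_of_notMem d h', unshuffleSign_succ_of_mem d h, ih,
        degreeSum_succ_of_mem d h, degreeSum_succ_of_notMem d h', mul_assoc,
        ← Int.negOnePow_add]
      congr 1
      rw [Int.negOnePow_eq_iff]
      exact ⟨-(d n * degreeSum d sᶜ n), by ring⟩
    · have h' : n ∈ sᶜ := h
      rw [unshuffleSign_succ_of_mem d h', unshuffleSign_succ_of_notMem d h, ih,
        degreeSum_succ_of_notMem d h, degreeSum_succ_of_mem d h', mul_assoc,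
        ← Int.negOnePow_add, compl_compl]
      congr 2
      ring

end Signs

/-! ### Iterated brackets along subsets and the Leibniz rule -/

section SubsetBracket

variable {K L : Type*} [Field K] [AddCommGroup L] [Module K L]

open Classical in
/-- The iterated bracket `[⋯[a, x_{k₁}], ⋯, x_{k_r}]`, where `k₁ < ⋯ < k_r` are the elements
of `s` below `n`. -/
noncomputable def subsetBracket (br : L →ₗ[K] L →ₗ[K] L) (x : ℕ → L) (s : Set ℕ) (n : ℕ)
    (a : L) : L :=
  (((List.range n).filter (fun k => k ∈ s)).map x).foldl (fun u v => br u v) a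

variable (br : L →ₗ[K] L →ₗ[K] L) (x : ℕ → L)

theorem subsetBracket_zero (s : Set ℕ) (a : L) : subsetBracket br x s 0 a = a := by
  simp [subsetBracket]

theorem subsetBracket_succ_of_mem {s : Set ℕ} {n : ℕ} (h : n ∈ s) (a : L) :
    subsetBracket br x s (n + 1) a = br (subsetBracket br x s n a) (x n) := by
  simp [subsetBracket, List.range_succ, List.filter_append, h]

theorem subsetBracket_succ_of_notMem {s : Set ℕ} {n : ℕ} (h : n ∉ s) (a : L) :
    subsetBracket br x s (n + 1) a = subsetBracket br x s n a := by
  simp [subsetBracket, List.range_succ, List.filter_append, h]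

theorem subsetBracket_congr {s t : Set ℕ} {n : ℕ} (h : ∀ k < n, k ∈ s ↔ k ∈ t) (a : L) :
    subsetBracket br x s n a = subsetBracket br x t n a := by
  unfold subsetBracket
  congr 2
  refine List.filter_congr fun k hk => ?_
  exact decide_eq_decide.mpr (h k (List.mem_range.mp hk))

theorem subsetBracket_apply_zero (s : Set ℕ) (n : ℕ) : subsetBracket br x s n 0 = 0 := by
  induction n with
  | zero => simp [subsetBracket_zero]
  | succ n ih =>
    by_cases h : n ∈ s
    · rw [subsetBracket_succ_of_mem br x h, ih, map_zero, LinearMap.zero_apply]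
    · rw [subsetBracket_succ_of_notMem br x h, ih]

end SubsetBracket

namespace IsGradedLieAlgebra

variable {K L : Type*} [Field K] [AddCommGroup L] [Module K L]
  {𝓖 : ℤ → Submodule K L} {br : L →ₗ[K] L →ₗ[K] L}

theorem bracket_intUnits_smul_left (u : ℤˣ) (x y : L) : br (u • x) y = u • br x y := by
  rw [Units.smul_def, Units.smul_def, map_zsmul, LinearMap.smul_apply]

/-- Bracketing with `z` on the right is a graded derivation. -/
theorem bracket_bracket (h : IsGradedLieAlgebra 𝓖 br) {a b c : ℤ} {x y z : L} (hx : x ∈ 𝓖 a)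
    (hy : y ∈ 𝓖 b) (hz : z ∈ 𝓖 c) :
    br (br x y) z = br x (br y z) + (b * c).negOnePow • br (br x z) y := by
  rw [h.jacobi a b c x y z hx hy hz, h.antisymm b (a + c) y (br x z) hy
    (h.bracket_mem a c x z hx hz), smul_neg, smul_smul, ← Int.negOnePow_add, add_assoc]
  have : (a * b + b * (a + c)).negOnePow = (b * c).negOnePow := by
    rw [Int.negOnePow_eq_iff]
    exact ⟨a * b, by ring⟩
  rw [this, neg_add_cancel, add_zero]

variable {x : ℕ → L} {d : ℕ → ℤ}

theorem subsetBracket_mem (h : IsGradedLieAlgebra 𝓖 br) (hx : ∀ k, x k ∈ 𝓖 (d k)) {α : ℤ} {a : L}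
    (ha : a ∈ 𝓖 α) (s : Set ℕ) (n : ℕ) :
    subsetBracket br x s n a ∈ 𝓖 (α + degreeSum d s n) := by
  induction n with
  | zero => simpa [subsetBracket_zero, degreeSum] using ha
  | succ n ih =>
    by_cases hn : n ∈ s
    · rw [subsetBracket_succ_of_mem br x hn, degreeSum_succ_of_mem d hn, ← add_assoc]
      exact h.bracket_mem _ _ _ _ ih (hx n)
    · rwa [subsetBracket_succ_of_notMem br x hn, degreeSum_succ_of_notMem d hn]

/-- The Leibniz rule for iterated brackets. -/
theorem subsetBracket_univ_bracket (h : IsGradedLieAlgebra 𝓖 br) (hx : ∀ k, x k ∈ 𝓖 (d k))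
    {α β : ℤ} {a b : L} (ha : a ∈ 𝓖 α) (hb : b ∈ 𝓖 β) (n : ℕ) :
    subsetBracket br x Set.univ n (br a b) =
      ∑ S ∈ (Finset.range n).powerset,
        (unshuffleSign d S n * (β * degreeSum d S n).negOnePow) •
          br (subsetBracket br x S n a) (subsetBracket br x (↑S)ᶜ n b) := by
  induction n with
  | zero => simp [subsetBracket_zero, unshuffleSign, degreeSum]
  | succ n ih =>
    -- The subsets of {0, …, n} come in pairs S, S ∪ {n}: the derivation rule brackets the new entry
    -- `x n` either into the factor of `b` or into that of `a`.
    rw [subsetBracket_succ_of_mem br x (Set.mem_univ n), ih, Finset.range_add_one,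
      Finset.sum_powerset_insert Finset.notMem_range_self, ← Finset.sum_add_distrib,
      map_sum, LinearMap.sum_apply]
    refine Finset.sum_congr rfl fun S hS => ?_
    have hn : n ∉ (S : Set ℕ) := fun hmem =>
      Finset.notMem_range_self (Finset.mem_powerset.mp hS hmem)
    have hn' : n ∈ ((S : Set ℕ)ᶜ) := hn
    have hi : n ∈ ((insert n S : Finset ℕ) : Set ℕ) := by simp
    have hi' : n ∉ (((insert n S : Finset ℕ) : Set ℕ)ᶜ) := by simp
    have hc : ∀ k < n, k ∈ ((insert n S : Finset ℕ) : Set ℕ) ↔ k ∈ (S : Set ℕ) := by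
      intro k hk
      simp [hk.ne]
    have hc' : ∀ k < n, k ∈ (((insert n S : Finset ℕ) : Set ℕ)ᶜ) ↔ k ∈ ((S : Set ℕ)ᶜ) :=
      fun k hk => not_congr (hc k hk)
    rw [unshuffleSign_succ_of_notMem d hn, unshuffleSign_succ_of_mem d hi,
      degreeSum_succ_of_notMem d hn, degreeSum_succ_of_mem d hi,
      subsetBracket_succ_of_notMem br x hn, subsetBracket_succ_of_mem br x hn',
      subsetBracket_succ_of_mem br x hi, subsetBracket_succ_of_notMem br x hi',
      subsetBracket_congr br x hc, subsetBracket_congr br x hc', degreeSum_congr d hc,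
      degreeSum_congr d hc', unshuffleSign_congr d hc, bracket_intUnits_smul_left,
      h.bracket_bracket (h.subsetBracket_mem hx ha _ n) (h.subsetBracket_mem hx hb _ n) (hx n),
      smul_add, smul_smul]
    congr 2
    rw [mul_assoc, mul_assoc, ← Int.negOnePow_add, ← Int.negOnePow_add]
    congr 2
    ring

/-- In an iterated bracket with commuting entries, the last entry can be moved to the front. -/
theorem bracket_subsetBracket (h : IsGradedLieAlgebra 𝓖 br) (hx : ∀ k, x k ∈ 𝓖 (d k))
    {α δ : ℤ} {a y : L} (ha : a ∈ 𝓖 α) (hy : y ∈ 𝓖 δ) (hxy : ∀ k, br (x k) y = 0)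
    (s : Set ℕ) (n : ℕ) :
    br (subsetBracket br x s n a) y =
      (δ * degreeSum d s n).negOnePow • subsetBracket br x s n (br a y) := by
  induction n with
  | zero => simp [subsetBracket_zero, degreeSum]
  | succ n ih =>
    by_cases hn : n ∈ s
    -- In [[u, x_n], y] = [u, [x_n, y]] ± [[u, y], x_n] the first term vanishes, so `y` moves past
    -- `x n` at the cost of a sign.
    · rw [subsetBracket_succ_of_mem br x hn, subsetBracket_succ_of_mem br x hn,
        degreeSum_succ_of_mem d hn,
        h.bracket_bracket (h.subsetBracket_mem hx ha _ n) (hx n) hy, hxy, map_zero, zero_add,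
        ih, bracket_intUnits_smul_left, smul_smul, ← Int.negOnePow_add]
      congr 2
      ring
    · rw [subsetBracket_succ_of_notMem br x hn, subsetBracket_succ_of_notMem br x hn,
        degreeSum_succ_of_notMem d hn, ih]

end IsGradedLieAlgebra

/-! ### The generalized Jacobi identity as a sum over subsets -/

namespace IsCurvedVData

variable {K L : Type*} [Field K] [AddCommGroup L] [Module K L]
  {𝓖 : ℤ → Submodule K L} {br : L →ₗ[K] L →ₗ[K] L} {F : Submodule K L} {P : L →ₗ[K] L} {Δ : L}

theorem proj_mem (h : IsCurvedVData 𝓖 br F P Δ) (u : L) : P u ∈ F :=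
  h.range_proj ▸ LinearMap.mem_range_self P u

/-- Expand P[u - Pu, v - Pv], which is zero because the kernel is a subalgebra; the term [Pu, Pv]
drops out because F is abelian. -/
theorem proj_bracket (h : IsCurvedVData 𝓖 br F P Δ) (u v : L) :
    P (br u v) = P (br (P u) v) + P (br u (P v)) := by
  have hk : ∀ w : L, w - P w ∈ LinearMap.ker P := fun w => by
    rw [LinearMap.mem_ker, map_sub, ← LinearMap.comp_apply, h.proj, sub_self]
  have h₁ : P (br (u - P u) (v - P v)) = 0 := h.ker_proj.bracket_mem _ (hk u) _ (hk v)
  have h₂ := h.abelian _ (h.proj_mem u) _ (h.proj_mem v)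
  simp only [map_sub, LinearMap.sub_apply, h₂, sub_zero] at h₁
  rw [← sub_eq_zero, ← h₁]
  abel

/-- The generalized Jacobi identity of the higher derived brackets, as a sum over subsets. -/
theorem sum_powerset_proj_eq_zero [CharZero K] (h : IsCurvedVData 𝓖 br F P Δ)
    (hP : ∀ (k : ℤ) (u : L), u ∈ 𝓖 k → P u ∈ 𝓖 k) {x : ℕ → L} {d : ℕ → ℤ}
    (hx : ∀ k, x k ∈ 𝓖 (d k)) (hxF : ∀ k, x k ∈ F) (n : ℕ) :
    ∑ S ∈ (Finset.range n).powerset, unshuffleSign d S n •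
      P (subsetBracket br x (↑S)ᶜ n (br Δ (P (subsetBracket br x S n Δ)))) = 0 := by
  have hG := h.gradedLie
  have hmem : ∀ s : Set ℕ, subsetBracket br x s n Δ ∈ 𝓖 (1 + degreeSum d s n) :=
    fun s => hG.subsetBracket_mem hx h.degree_one s n
  have hPmem : ∀ s : Set ℕ, P (subsetBracket br x s n Δ) ∈ 𝓖 (1 + degreeSum d s n) :=
    fun s => hP _ _ (hmem s)
  -- The projected bracket lies in F, hence commutes with every entry and can be pulled inwards next
  -- to Δ.
  have move : ∀ s t : Set ℕ, br (subsetBracket br x t n Δ) (P (subsetBracket br x s n Δ)) =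
      ((1 + degreeSum d s n) * degreeSum d t n).negOnePow •
        subsetBracket br x t n (br Δ (P (subsetBracket br x s n Δ))) := fun s t =>
    hG.bracket_subsetBracket hx h.degree_one (hPmem s)
      (fun k => h.abelian _ (hxF k) _ (h.proj_mem _)) t n
  have hsplit : ∀ S : Finset ℕ,
      (unshuffleSign d S n * (1 * degreeSum d S n).negOnePow) •
        P (br (subsetBracket br x S n Δ) (subsetBracket br x (↑S)ᶜ n Δ)) =
      unshuffleSign d S n •
        P (subsetBracket br x (↑S)ᶜ n (br Δ (P (subsetBracket br x S n Δ)))) +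
      unshuffleSign d (↑S)ᶜ n •
        P (subsetBracket br x S n (br Δ (P (subsetBracket br x (↑S)ᶜ n Δ)))) := by
    intro S
    rw [h.proj_bracket, smul_add]
    congr 1
    -- Antisymmetry, `move` and the Leibniz sign contribute the exponent 2(1 + d_S)(1 + d_{Sᶜ}), so
    -- no extra sign is left.
    · rw [hG.antisymm _ _ _ _ (hPmem S) (hmem (↑S)ᶜ), move, smul_smul, ← Int.negOnePow_add,
        map_neg, map_intUnits_smul, neg_intUnits_smul, smul_smul, mul_assoc,
        ← Int.negOnePow_succ, ← Int.negOnePow_add, Int.negOnePow_even, mul_one]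
      exact ⟨(1 + degreeSum d S n) * (1 + degreeSum d (↑S)ᶜ n), by ring⟩
    -- Here the exponent is d_S · d_{Sᶜ} up to an even number, which is exactly what turns the sign
    -- of S into that of Sᶜ.
    · rw [move, map_intUnits_smul, smul_smul, unshuffleSign_compl, mul_assoc,
        ← Int.negOnePow_add]
      congr 2
      rw [Int.negOnePow_eq_iff]
      exact ⟨degreeSum d S n, by ring⟩
  have hzero : ∑ S ∈ (Finset.range n).powerset,
      (unshuffleSign d S n * (1 * degreeSum d S n).negOnePow) •
        P (br (subsetBracket br x S n Δ) (subsetBracket br x (↑S)ᶜ n Δ)) = 0 := by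
    have := congrArg P (hG.subsetBracket_univ_bracket hx h.degree_one h.degree_one n)
    rw [h.square_zero, subsetBracket_apply_zero, map_zero, map_sum] at this
    simpa only [map_intUnits_smul] using this.symm
  -- Complementation in {0, …, n-1} identifies the two halves of the sum.
  have hswap : ∑ S ∈ (Finset.range n).powerset, unshuffleSign d (↑S)ᶜ n •
        P (subsetBracket br x S n (br Δ (P (subsetBracket br x (↑S)ᶜ n Δ)))) =
      ∑ S ∈ (Finset.range n).powerset, unshuffleSign d S n •
        P (subsetBracket br x (↑S)ᶜ n (br Δ (P (subsetBracket br x S n Δ)))) := by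
    refine Finset.sum_nbij' (fun S => Finset.range n \ S) (fun S => Finset.range n \ S)
      (fun S _ => Finset.mem_powerset.mpr Finset.sdiff_subset)
      (fun S _ => Finset.mem_powerset.mpr Finset.sdiff_subset)
      (fun S hS => Finset.sdiff_sdiff_eq_self (Finset.mem_powerset.mp hS))
      (fun S hS => Finset.sdiff_sdiff_eq_self (Finset.mem_powerset.mp hS)) fun S _ => ?_
    have h₁ : ∀ k < n, k ∈ ((Finset.range n \ S : Finset ℕ) : Set ℕ) ↔ k ∈ ((S : Set ℕ)ᶜ) := by
      intro k hk
      simp [hk]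
    have h₂ : ∀ k < n, k ∈ (((Finset.range n \ S : Finset ℕ) : Set ℕ)ᶜ) ↔ k ∈ (S : Set ℕ) := by
      intro k hk
      simp [hk]
    rw [unshuffleSign_congr d h₁, subsetBracket_congr br x h₁, subsetBracket_congr br x h₂]
  simp only [hsplit, Finset.sum_add_distrib] at hzero
  -- The Jacobi expression has been obtained twice; 2 is invertible in characteristic 0.
  rw [hswap, ← two_smul K] at hzero
  exact (smul_eq_zero.mp hzero).resolve_left two_ne_zero

end IsCurvedVData

/-! ### Koszul signs of permutations -/

section KoszulSign

theorem prod_eq_prod_lt_mul_swap {ι M : Type*} [Fintype ι] [LinearOrder ι] [CommMonoid M]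
    (f : ι × ι → M) (h : ∀ a, f (a, a) = 1) :
    ∏ p, f p = ∏ p : ι × ι, if p.1 < p.2 then f p * f p.swap else 1 := by
  have h₁ : ∏ p : ι × ι, (if p.2 < p.1 then f p else 1) =
      ∏ p : ι × ι, (if p.1 < p.2 then f p.swap else 1) :=
    Fintype.prod_equiv (Equiv.prodComm ι ι) _ _ fun p => by simp
  calc ∏ p, f p
      = ∏ p : ι × ι, (if p.1 < p.2 then f p else 1) * (if p.2 < p.1 then f p else 1) := by
        refine Finset.prod_congr rfl fun p _ => ?_
        obtain ⟨a, b⟩ := p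
        rcases lt_trichotomy a b with hab | rfl | hab
        · simp [hab, hab.not_gt]
        · simp [h]
        · simp [hab, hab.not_gt]
    _ = _ := by
        rw [Finset.prod_mul_distrib, h₁, ← Finset.prod_mul_distrib]
        refine Finset.prod_congr rfl fun p _ => ?_
        split_ifs <;> simp

/-- The cocycle rule is checked on each unordered pair: `σ * τ` inverts a pair when exactly one of
`τ` on it and `σ` on its image does, and a double inversion contributes a square of a sign.
Reindexing the sign of `σ` by `τ` makes the two products run over the same pairs. -/
theorem koszulSign_mul {n : ℕ} (d : Fin n → ℤ) (σ τ : Equiv.Perm (Fin n)) :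
    koszulSign d (σ * τ) = koszulSign d σ * koszulSign (fun a => d (σ a)) τ := by
  have h₁ : koszulSign d σ = ∏ p : Fin n × Fin n, if τ p.1 < τ p.2 ∧ σ (τ p.2) < σ (τ p.1) then
      (d (σ (τ p.1)) * d (σ (τ p.2))).negOnePow else 1 :=
    (Fintype.prod_equiv (Equiv.prodCongr τ τ) _ _ fun p => by simp).symm
  rw [h₁, prod_eq_prod_lt_mul_swap _ (by simp), koszulSign, koszulSign,
    ← Finset.prod_mul_distrib]
  refine Finset.prod_congr rfl fun p _ => ?_
  obtain ⟨a, b⟩ := p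
  simp only [Equiv.Perm.mul_apply, Prod.fst_swap, Prod.snd_swap]
  by_cases hab : a < b
  · have hτ : τ a ≠ τ b := fun h => hab.ne (τ.injective h)
    have hσ : σ (τ a) ≠ σ (τ b) := fun h => hτ (σ.injective h)
    simp only [hab, true_and, if_true]
    rcases hτ.lt_or_gt with h | h <;> rcases hσ.lt_or_gt with h' | h' <;>
      simp [h, h', h.not_gt, h'.not_gt, mul_comm (d (σ (τ b)))]
  · simp [hab]

theorem koszulSign_one {n : ℕ} (d : Fin n → ℤ) : koszulSign d 1 = 1 := by
  refine Finset.prod_eq_one fun p _ => if_neg fun h => ?_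
  exact h.1.not_gt h.2

theorem koszulSign_swap {n : ℕ} (d : Fin (n + 1) → ℤ) (i : Fin n) :
    koszulSign d (Equiv.swap i.castSucc i.succ) =
      (d i.castSucc * d i.succ).negOnePow := by
  rw [koszulSign, Finset.prod_eq_single (i.castSucc, i.succ)]
  · simp [mul_comm]
  · rintro ⟨a, b⟩ - hab
    refine if_neg fun h => hab ?_
    obtain ⟨h₁, h₂⟩ := h
    simp only [Equiv.swap_apply_def, Fin.ext_iff, Fin.lt_def, Prod.mk.injEq, Fin.val_castSucc,
      Fin.val_succ] at h₁ h₂ ⊢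
    split_ifs at h₂ <;> (try simp only [Fin.val_castSucc, Fin.val_succ] at h₂) <;> omega
  · simp

end KoszulSign

/-! ### Finite families as sequences, and brackets along increasing enumerations -/

section Extension

/-- The extension of a finite sequence by zero. -/
def extendZero {M : Type*} [Zero M] {n : ℕ} (x : Fin n → M) (k : ℕ) : M :=
  if h : k < n then x ⟨k, h⟩ else 0

theorem extendZero_val {M : Type*} [Zero M] {n : ℕ} (x : Fin n → M) (a : Fin n) :
    extendZero x a = x a := by
  simp [extendZero]

theorem degreeSum_univ_extendZero {n : ℕ} (d : Fin n → ℤ) :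
    degreeSum (extendZero d) Set.univ n = ∑ a, d a := by
  simp [degreeSum, Finset.sum_range, extendZero_val]

variable {K L : Type*} [Field K] [AddCommGroup L] [Module K L]

theorem extendZero_mem {𝓖 : ℤ → Submodule K L} {n : ℕ} {x : Fin n → L} {d : Fin n → ℤ}
    (h : ∀ a, x a ∈ 𝓖 (d a)) (k : ℕ) : extendZero x k ∈ 𝓖 (extendZero d k) := by
  unfold extendZero
  split_ifs
  · exact h _
  · exact zero_mem _

theorem iteratedBracket_eq_foldl (br : L →ₗ[K] L →ₗ[K] L) (a : L) (k : ℕ) (x : Fin k → L) :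
    iteratedBracket br a k x = (List.ofFn x).foldl (fun u v => br u v) a := by
  induction k with
  | zero => simp [iteratedBracket]
  | succ k ih =>
    rw [List.ofFn_succ_last, List.foldl_append, List.foldl_cons, List.foldl_nil, ← ih]
    rfl

/-- Two strictly increasing lists with the same members agree. This translates increasing
enumerations by `Fin k`, as in shuffles, into subsets of `ℕ`. -/
theorem List.ofFn_val_eq_filter_range {k n : ℕ} {τ : Fin k → Fin n} (hτ : StrictMono τ)
    (p : ℕ → Prop) [DecidablePred p] (hp : ∀ v : Fin n, p v ↔ v ∈ Set.range τ) :
    List.ofFn (fun a => (τ a : ℕ)) = (List.range n).filter (fun m => p m) := by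
  refine List.Pairwise.eq_of_mem_iff (r := (· < ·)) ?_ ?_ fun m => ?_
  · exact List.pairwise_ofFn.mpr fun _ _ hab => hτ hab
  · exact List.pairwise_lt_range.filter _
  · simp only [List.mem_ofFn, List.mem_filter, List.mem_range, decide_eq_true_eq]
    constructor
    · rintro ⟨a, rfl⟩
      exact ⟨(τ a).2, (hp _).mpr ⟨a, rfl⟩⟩
    · rintro ⟨hm, hpm⟩
      obtain ⟨a, ha⟩ := (hp ⟨m, hm⟩).mp hpm
      exact ⟨a, by rw [ha]⟩

theorem foldl_ofFn_eq_subsetBracket (br : L →ₗ[K] L →ₗ[K] L) (a : L) {k n : ℕ} {x : Fin n → L}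
    {τ : Fin k → Fin n} (hτ : StrictMono τ) {s : Set ℕ}
    (hs : ∀ v : Fin n, (v : ℕ) ∈ s ↔ v ∈ Set.range τ) :
    (List.ofFn fun b => x (τ b)).foldl (fun u v => br u v) a =
      subsetBracket br (extendZero x) s n a := by
  classical
  rw [subsetBracket, ← List.ofFn_val_eq_filter_range hτ (· ∈ s) hs, List.map_ofFn]
  congr 2
  funext b
  simp [extendZero_val]

theorem iteratedBracket_eq_subsetBracket (br : L →ₗ[K] L →ₗ[K] L) (a : L) {k n : ℕ}
    {x : Fin n → L} {τ : Fin k → Fin n} (hτ : StrictMono τ) {s : Set ℕ}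
    (hs : ∀ v : Fin n, (v : ℕ) ∈ s ↔ v ∈ Set.range τ) :
    iteratedBracket br a k (fun b => x (τ b)) = subsetBracket br (extendZero x) s n a := by
  rw [iteratedBracket_eq_foldl, foldl_ofFn_eq_subsetBracket br a hτ hs]

theorem iteratedBracket_eq_subsetBracket_univ (br : L →ₗ[K] L →ₗ[K] L) (a : L) {n : ℕ}
    (x : Fin n → L) :
    iteratedBracket br a n x = subsetBracket br (extendZero x) Set.univ n a :=
  iteratedBracket_eq_subsetBracket br a (τ := id) strictMono_id (by simp)

theorem iteratedBracket_cons (br : L →ₗ[K] L →ₗ[K] L) (a y : L) {k n : ℕ} {x : Fin n → L}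
    {τ : Fin k → Fin n} (hτ : StrictMono τ) {s : Set ℕ}
    (hs : ∀ v : Fin n, (v : ℕ) ∈ s ↔ v ∈ Set.range τ) :
    iteratedBracket br a (k + 1) (Fin.cons y fun b => x (τ b)) =
      subsetBracket br (extendZero x) s n (br a y) := by
  rw [iteratedBracket_eq_foldl, List.ofFn_succ, List.foldl_cons, Fin.cons_zero]
  simp only [Fin.cons_succ]
  exact foldl_ofFn_eq_subsetBracket br _ hτ hs

end Extension

/-! ### Shuffles as subsets -/

section Shuffles

/-- The image of the first `i` positions under `σ`. -/
def firstBlock {n : ℕ} (i : ℕ) (σ : Equiv.Perm (Fin n)) : Finset ℕ :=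
  (Finset.univ.filter fun a : Fin n => (a : ℕ) < i).image fun a => (σ a : ℕ)

theorem val_apply_mem_firstBlock {n i : ℕ} {σ : Equiv.Perm (Fin n)} (a : Fin n) :
    (σ a : ℕ) ∈ firstBlock i σ ↔ (a : ℕ) < i := by
  simp only [firstBlock, Finset.mem_image, Finset.mem_filter, Finset.mem_univ, true_and]
  constructor
  · rintro ⟨b, hb, h⟩
    rwa [← σ.injective (Fin.ext h)]
  · exact fun h => ⟨a, h, rfl⟩

theorem firstBlock_subset {n : ℕ} (i : ℕ) (σ : Equiv.Perm (Fin n)) :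
    firstBlock i σ ⊆ Finset.range n := by
  intro m hm
  obtain ⟨a, -, rfl⟩ := Finset.mem_image.mp hm
  exact Finset.mem_range.mpr (σ a).2

theorem card_firstBlock {n i : ℕ} (hi : i ≤ n) (σ : Equiv.Perm (Fin n)) :
    (firstBlock i σ).card = i := by
  rw [firstBlock, Finset.card_image_of_injective _ fun a b h => σ.injective (Fin.ext h),
    Fin.card_filter_val_lt, min_eq_right hi]

theorem mem_shuffles {n i : ℕ} {σ : Equiv.Perm (Fin n)} : σ ∈ shuffles n i ↔ IsShuffle i σ := by
  simp [shuffles]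

namespace IsShuffle

variable {n i : ℕ} {σ : Equiv.Perm (Fin n)}

theorem strictMono_left (h : IsShuffle i σ) (hi : i ≤ n) :
    StrictMono fun a : Fin i => σ ⟨a, a.2.trans_le hi⟩ := fun _ b hab =>
  h _ _ hab (Or.inl b.2)

theorem strictMono_right (h : IsShuffle i σ) :
    StrictMono fun b : Fin (n - i) => σ ⟨i + b, by omega⟩ := fun _ _ hab =>
  h _ _ (Nat.add_lt_add_left hab i) (Or.inr (Nat.le_add_right _ _))

theorem mem_firstBlock_iff (hi : i ≤ n) (v : Fin n) :
    (v : ℕ) ∈ (firstBlock i σ : Set ℕ) ↔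
      v ∈ Set.range fun a : Fin i => σ ⟨a, a.2.trans_le hi⟩ := by
  obtain ⟨a, rfl⟩ := σ.surjective v
  rw [Finset.mem_coe, val_apply_mem_firstBlock]
  constructor
  · exact fun h => ⟨⟨a, h⟩, rfl⟩
  · rintro ⟨b, hb⟩
    rw [← σ.injective hb]
    exact b.2

theorem mem_compl_firstBlock_iff (v : Fin n) :
    (v : ℕ) ∈ ((firstBlock i σ : Set ℕ)ᶜ) ↔
      v ∈ Set.range fun b : Fin (n - i) => σ ⟨i + b, by omega⟩ := by
  obtain ⟨a, rfl⟩ := σ.surjective v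
  rw [Set.mem_compl_iff, Finset.mem_coe, val_apply_mem_firstBlock]
  constructor
  · exact fun h => ⟨⟨a - i, by omega⟩, congrArg σ (Fin.ext (by simp only; omega))⟩
  · rintro ⟨b, hb⟩
    rw [← σ.injective hb]
    simp

/-- A shuffle is increasing on each block, so its inversions are precisely the pairs of a value in
the first block above a value in the second. -/
theorem koszulSign_eq (h : IsShuffle i σ) (d : Fin n → ℤ) :
    koszulSign d σ = unshuffleSign (extendZero d) (firstBlock i σ) n := by
  classical
  have h₁ : koszulSign d σ = ∏ p : Fin n × Fin n, if p.2 < p.1 ∧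
      (p.1 : ℕ) ∈ (firstBlock i σ : Set ℕ) ∧ (p.2 : ℕ) ∉ (firstBlock i σ : Set ℕ) then
      (d p.1 * d p.2).negOnePow else 1 := by
    refine Fintype.prod_equiv (Equiv.prodCongr σ σ) _ _ fun p => ?_
    simp only [Equiv.prodCongr_apply, Prod.map_fst, Prod.map_snd, Finset.mem_coe,
      val_apply_mem_firstBlock]
    refine if_congr ⟨fun hp => ⟨hp.2, ?_⟩, fun hp => ⟨Fin.lt_def.mpr (by omega), hp.1⟩⟩ rfl rfl
    by_contra hc
    refine hp.2.not_gt (h _ _ hp.1 ?_)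
    have := Fin.lt_def.mp hp.1
    omega
  have h₂ : unshuffleSign (extendZero d) (firstBlock i σ) n =
      ∏ a : Fin n, ∏ b : Fin n, if b < a ∧
      (a : ℕ) ∈ (firstBlock i σ : Set ℕ) ∧ (b : ℕ) ∉ (firstBlock i σ : Set ℕ) then
      (d a * d b).negOnePow else 1 := by
    rw [unshuffleSign, Finset.prod_range]
    refine Finset.prod_congr rfl fun a _ => ?_
    have h₃ : Finset.range (a : ℕ) = (Finset.range n).filter (· < (a : ℕ)) := by
      ext m
      simp only [Finset.mem_range, Finset.mem_filter]
      omega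
    rw [h₃, Finset.prod_filter, Finset.prod_range]
    refine Finset.prod_congr rfl fun b _ => ?_
    rw [extendZero_val, extendZero_val, ite_and (b < a)]
    refine if_congr Iff.rfl ?_ rfl
    congr
  rw [h₁, h₂, Fintype.prod_prod_type]

end IsShuffle

theorem exists_isShuffle_firstBlock_eq {n : ℕ} {S : Finset ℕ} (hS : S ⊆ Finset.range n) :
    ∃ i ≤ n, ∃ σ : Equiv.Perm (Fin n), IsShuffle i σ ∧ firstBlock i σ = S := by
  classical
  let U : Finset (Fin n) := Finset.univ.filter fun a => (a : ℕ) ∈ S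
  have hUn : U.card ≤ n := by simpa using U.card_le_univ
  have hUc : Uᶜ.card = n - U.card := by rw [Finset.card_compl, Fintype.card_fin]
  -- The shuffle lists the elements of `U` in increasing order, followed by those of the complement.
  let σ : Equiv.Perm (Fin n) :=
    ((finCongr (by omega : n = U.card + (n - U.card))).trans finSumFinEquiv.symm).trans
      (finSumEquivOfFinset rfl hUc)
  have hl : ∀ (a : Fin n) (ha : (a : ℕ) < U.card), σ a = U.orderEmbOfFin rfl ⟨a, ha⟩ := by
    intro a ha
    have : finCongr (by omega : n = U.card + (n - U.card)) a =
      Fin.castAdd (n - U.card) ⟨a, ha⟩ := rfl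
    simp only [σ, Equiv.trans_apply, this, finSumFinEquiv_symm_apply_castAdd,
      finSumEquivOfFinset_inl]
  have hr : ∀ (a : Fin n) (ha : U.card ≤ (a : ℕ)),
      σ a = Uᶜ.orderEmbOfFin hUc ⟨a - U.card, by omega⟩ := by
    intro a ha
    have : finCongr (by omega : n = U.card + (n - U.card)) a =
      Fin.natAdd U.card ⟨a - U.card, by omega⟩ := Fin.ext (by simp; omega)
    simp only [σ, Equiv.trans_apply, this, finSumFinEquiv_symm_apply_natAdd,
      finSumEquivOfFinset_inr]
  refine ⟨U.card, hUn, σ, ?_, ?_⟩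
  · intro a b hab h
    have hab' : (a : ℕ) < b := hab
    rcases h with h | h
    · rw [hl a (hab'.trans h), hl b h, OrderEmbedding.lt_iff_lt]
      exact hab
    · rw [hr a h, hr b (h.trans hab'.le), OrderEmbedding.lt_iff_lt]
      exact Fin.lt_def.mpr (by simp only; omega)
  · refine Finset.eq_of_subset_of_card_le ?_ ?_
    · intro m hm
      obtain ⟨a, ha, rfl⟩ := Finset.mem_image.mp hm
      have := Finset.orderEmbOfFin_mem U rfl ⟨a, (Finset.mem_filter.mp ha).2⟩
      rw [← hl a] at this
      exact (Finset.mem_filter.mp this).2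
    · rw [card_firstBlock hUn]
      calc S.card ≤ (U.image fun a : Fin n => (a : ℕ)).card := Finset.card_le_card fun m hm =>
            Finset.mem_image.mpr ⟨⟨m, Finset.mem_range.mp (hS hm)⟩, by simp [U, hm], rfl⟩
        _ ≤ U.card := Finset.card_image_le

/-- Shuffles are the same as subsets. -/
theorem sum_shuffles {M : Type*} [AddCommMonoid M] (n : ℕ) (g : Finset ℕ → M) :
    ∑ i : Fin (n + 1), ∑ σ ∈ shuffles n i, g (firstBlock i σ) =
      ∑ S ∈ (Finset.range n).powerset, g S := by
  rw [Finset.sum_sigma']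
  refine Finset.sum_bij (fun p _ => firstBlock p.1 p.2)
    (fun p _ => Finset.mem_powerset.mpr (firstBlock_subset _ _)) ?_ ?_ fun _ _ => rfl
  · rintro ⟨i, σ⟩ hσ ⟨j, τ⟩ hτ h
    simp only [Finset.mem_sigma, Finset.mem_univ, true_and, mem_shuffles] at hσ hτ h
    have hi : (i : ℕ) ≤ n := Nat.lt_succ_iff.mp i.2
    -- The cardinality of the first block recovers `i`; the increasing enumerations of both blocks
    -- then recover the permutation.
    have hij : i = j := by
      have := congrArg Finset.card h
      rw [card_firstBlock hi, card_firstBlock (Nat.lt_succ_iff.mp j.2)] at this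
      exact Fin.ext this
    subst hij
    classical
    have hl := (List.ofFn_val_eq_filter_range (hσ.strictMono_left hi)
      (· ∈ (firstBlock i σ : Set ℕ)) (IsShuffle.mem_firstBlock_iff hi)).trans
      ((List.ofFn_val_eq_filter_range (hτ.strictMono_left hi)
      (· ∈ (firstBlock i σ : Set ℕ)) (h ▸ IsShuffle.mem_firstBlock_iff hi)).symm)
    have hr := (List.ofFn_val_eq_filter_range hσ.strictMono_right
      (· ∈ (firstBlock i σ : Set ℕ)ᶜ) IsShuffle.mem_compl_firstBlock_iff).trans
      ((List.ofFn_val_eq_filter_range hτ.strictMono_right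
      (· ∈ (firstBlock i σ : Set ℕ)ᶜ) (h ▸ IsShuffle.mem_compl_firstBlock_iff)).symm)
    have hστ : σ = τ := by
      ext a
      by_cases ha : (a : ℕ) < i
      · exact congrFun (List.ofFn_injective hl) ⟨a, ha⟩
      · have := congrFun (List.ofFn_injective hr) ⟨a - i, by omega⟩
        have ha' : (⟨i + (a - i), by omega⟩ : Fin n) = a := Fin.ext (by simp only; omega)
        simpa only [ha'] using this
    rw [hστ]
  · intro S hS
    obtain ⟨i, hi, σ, hσ, h⟩ := exists_isShuffle_firstBlock_eq (Finset.mem_powerset.mp hS)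
    exact ⟨⟨⟨i, Nat.lt_succ_iff.mpr hi⟩, σ⟩, by simpa [mem_shuffles] using hσ, h⟩

end Shuffles

/-! ### Graded symmetry of iterated brackets with commuting entries -/

namespace IsGradedLieAlgebra

variable {K L : Type*} [Field K] [AddCommGroup L] [Module K L]
  {𝓖 : ℤ → Submodule K L} {br : L →ₗ[K] L →ₗ[K] L}

/-- The brackets before position `k` are unchanged, the derivation rule with [x_{k+1}, x_k] = 0
exchanges the two entries, and the later brackets carry the sign along. -/
theorem subsetBracket_univ_swap (h : IsGradedLieAlgebra 𝓖 br) {x : ℕ → L} {d : ℕ → ℤ}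
    (hx : ∀ k, x k ∈ 𝓖 (d k)) (hxx : ∀ j k, br (x j) (x k) = 0) {α : ℤ} {a : L} (ha : a ∈ 𝓖 α)
    {k n : ℕ} (hk : k + 1 < n) :
    subsetBracket br (fun m => x (Equiv.swap k (k + 1) m)) Set.univ n a =
      (d k * d (k + 1)).negOnePow • subsetBracket br x Set.univ n a := by
  have low : ∀ m ≤ k, subsetBracket br (fun m => x (Equiv.swap k (k + 1) m)) Set.univ m a =
      subsetBracket br x Set.univ m a := by
    intro m hm
    induction m with
    | zero => rw [subsetBracket_zero, subsetBracket_zero]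
    | succ m ih =>
      rw [subsetBracket_succ_of_mem br _ (Set.mem_univ m),
        subsetBracket_succ_of_mem br _ (Set.mem_univ m), ih (by omega),
        Equiv.swap_apply_of_ne_of_ne (by omega) (by omega)]
  induction n with
  | zero => omega
  | succ n ih =>
    rcases Nat.lt_succ_iff_lt_or_eq.mp hk with hn | rfl
    · rw [subsetBracket_succ_of_mem br _ (Set.mem_univ n),
        subsetBracket_succ_of_mem br _ (Set.mem_univ n), ih hn,
        Equiv.swap_apply_of_ne_of_ne (by omega) (by omega), bracket_intUnits_smul_left]
    · simp only [subsetBracket_succ_of_mem br _ (Set.mem_univ _), low k le_rfl,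
        Equiv.swap_apply_left, Equiv.swap_apply_right]
      rw [h.bracket_bracket (h.subsetBracket_mem hx ha _ _) (hx (k + 1)) (hx k), hxx, map_zero,
        zero_add, mul_comm]

theorem iteratedBracket_perm (h : IsGradedLieAlgebra 𝓖 br) {α : ℤ} {a : L} (ha : a ∈ 𝓖 α) {n : ℕ}
    {d : Fin n → ℤ} {x : Fin n → L} (hx : ∀ b, x b ∈ 𝓖 (d b))
    (hxx : ∀ b c, br (x b) (x c) = 0) (σ : Equiv.Perm (Fin n)) :
    iteratedBracket br a n (fun b => x (σ b)) = koszulSign d σ • iteratedBracket br a n x := by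
  cases n with
  | zero =>
    rw [Subsingleton.elim σ 1, koszulSign_one, one_smul]
    rfl
  | succ n =>
    have hσ : σ ∈ Submonoid.closure
        (Set.range fun i : Fin n ↦ Equiv.swap i.castSucc i.succ) := by
      rw [Equiv.Perm.mclosure_swap_castSucc_succ]
      trivial
    -- Adjacent transpositions generate. The product case applies the hypothesis for `τ` to the
    -- degrees and entries permuted by `σ`, hence the generalization.
    induction hσ using Submonoid.closure_induction generalizing d x with
    | mem σ hσ =>
      obtain ⟨i, rfl⟩ := hσ
      have hxx' : ∀ j k, br (extendZero x j) (extendZero x k) = 0 := by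
        intro j k
        simp only [extendZero]
        split_ifs <;> simp [hxx]
      have hs := h.subsetBracket_univ_swap (extendZero_mem hx) hxx' ha
        (k := i) (n := n + 1) (by omega)
      rw [iteratedBracket_eq_subsetBracket_univ, iteratedBracket_eq_subsetBracket_univ,
        koszulSign_swap, ← extendZero_val d i.castSucc, ← extendZero_val d i.succ]
      refine Eq.trans ?_ hs
      congr 1
      funext m
      simp only [extendZero, Equiv.swap_apply_def, Fin.ext_iff, Fin.val_castSucc, Fin.val_succ]
      have := i.2
      split_ifs <;> first | rfl | omega
    | one => rw [koszulSign_one, one_smul]; rfl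
    | mul σ τ _ _ hσ hτ =>
      rw [koszulSign_mul, mul_comm, mul_smul, ← hσ hx hxx]
      exact hτ (fun b => hx (σ b)) (fun b c => hxx _ _)

end IsGradedLieAlgebra

/-! ### The curved L∞-algebra of a curved V-data -/

section InducedGrading

variable {K L : Type*} [Field K] [AddCommGroup L] [Module K L]

theorem isInternal_inducedGrading {𝓖 : ℤ → Submodule K L} (h : DirectSum.IsInternal 𝓖)
    {F : Submodule K L} (hF : F = ⨆ k : ℤ, F ⊓ 𝓖 k) :
    DirectSum.IsInternal (inducedGrading 𝓖 F) := by
  have hmap : ∀ k, (inducedGrading 𝓖 F k).map F.subtype = F ⊓ 𝓖 k := fun k =>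
    Submodule.map_comap_subtype _ _
  rw [DirectSum.isInternal_submodule_iff_iSupIndep_and_iSup_eq_top] at h ⊢
  constructor
  · intro k
    rw [Submodule.disjoint_def]
    intro y hy hy'
    have h₁ := Submodule.mem_map_of_mem (f := F.subtype) hy'
    simp only [Submodule.map_iSup, hmap] at h₁
    have h₂ : (⨆ j, ⨆ _ : j ≠ k, F ⊓ 𝓖 j) ≤ ⨆ j, ⨆ _ : j ≠ k, 𝓖 j :=
      iSup₂_mono fun _ _ => inf_le_right
    exact Subtype.ext (Submodule.disjoint_def.mp (h.1 k) y hy (h₂ h₁))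
  · apply Submodule.map_injective_of_injective F.subtype_injective
    rw [Submodule.map_iSup, Submodule.map_subtype_top]
    simp only [hmap]
    exact hF.symm

end InducedGrading

namespace IsCurvedVData

variable {K L : Type*} [Field K] [CharZero K] [AddCommGroup L] [Module K L]
  {𝓖 : ℤ → Submodule K L} {br : L →ₗ[K] L →ₗ[K] L} {F : Submodule K L} {P : L →ₗ[K] L} {Δ : L}

/-- The higher derived brackets of a curved V-data form a curved `L∞`-algebra. -/
theorem isCurvedLInfinity (h : IsCurvedVData 𝓖 br F P Δ)
    (hP : ∀ (k : ℤ) (u : L), u ∈ 𝓖 k → P u ∈ 𝓖 k) (hPF : ∀ u, P u ∈ F) :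
    IsCurvedLInfinity (V := F) (inducedGrading 𝓖 F) (derivedBracket br F P hPF Δ) where
  isInternal := isInternal_inducedGrading h.gradedLie.isInternal h.subalgebra.homogeneous
  degree_one n d x hx := by
    have hx' : ∀ a, (x a : L) ∈ 𝓖 (d a) := hx
    change P (iteratedBracket br Δ n fun a => (x a : L)) ∈ 𝓖 _
    rw [iteratedBracket_eq_subsetBracket_univ, add_comm, ← degreeSum_univ_extendZero]
    exact hP _ _ (h.gradedLie.subsetBracket_mem (extendZero_mem hx') h.degree_one _ _)
  graded_symm n d x hx σ := by
    have hx' : ∀ a, (x a : L) ∈ 𝓖 (d a) := hx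
    refine Subtype.ext ?_
    rw [← F.subtype_apply, ← F.subtype_apply, map_intUnits_smul]
    change P (iteratedBracket br Δ n fun a => (x (σ a) : L)) =
      koszulSign d σ • P (iteratedBracket br Δ n fun a => (x a : L))
    rw [← map_intUnits_smul, h.gradedLie.iteratedBracket_perm h.degree_one hx'
      (fun b c => h.abelian _ (x b).2 _ (x c).2) σ]
  jacobi n d x hx := by
    have hx' : ∀ a, (x a : L) ∈ 𝓖 (d a) := hx
    have hxF : ∀ k, extendZero (fun a => (x a : L)) k ∈ F := fun k => by
      unfold extendZero
      split_ifs
      · exact (x _).2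
      · exact zero_mem _
    have key := h.sum_powerset_proj_eq_zero hP (extendZero_mem hx') hxF n
    rw [← sum_shuffles] at key
    refine Subtype.ext ?_
    rw [← F.subtype_apply, ZeroMemClass.coe_zero, ← key, map_sum]
    refine Finset.sum_congr rfl fun i _ => ?_
    rw [map_sum]
    refine Finset.sum_congr rfl fun σ hσ => ?_
    have hi : (i : ℕ) ≤ n := Nat.lt_succ_iff.mp i.2
    rw [mem_shuffles] at hσ
    rw [map_intUnits_smul, hσ.koszulSign_eq]
    congr 1
    -- The inner operation brackets along the first block; the outer one takes its value as first
    -- entry and brackets along the complement.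
    have h₁ := iteratedBracket_eq_subsetBracket br Δ (x := fun a => (x a : L))
      (hσ.strictMono_left hi) (IsShuffle.mem_firstBlock_iff hi)
    have h₂ := iteratedBracket_cons br Δ
      (P (subsetBracket br (extendZero fun a => (x a : L)) (firstBlock i σ) n Δ))
      (x := fun a => (x a : L)) hσ.strictMono_right IsShuffle.mem_compl_firstBlock_iff
    rw [← h₂, ← h₁]
    refine congrArg P (congrArg (iteratedBracket br Δ (n - i + 1)) (funext fun b => ?_))
    refine Fin.cases ?_ (fun b => ?_) b
    · rfl
    · rfl

end IsCurvedVData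

/-! ### Evaluation of cochains on infinite sequences -/

section SequenceEvaluation

variable {K V W : Type*} [Field K] [AddCommGroup V] [Module K V] [AddCommGroup W] [Module K W]

/-- The value of a cochain of degree `n` at the first `n + 1` terms of a sequence. -/
def evalSeq {n : ℕ} (f : Cochain K V W n) (x : ℕ → V) : W := f fun i => x i

theorem evalSeq_injective {n : ℕ} {f g : Cochain K V W n}
    (h : ∀ x, evalSeq f x = evalSeq g x) : f = g := by
  refine MultilinearMap.ext fun y => ?_
  have := h (extendZero y)
  simpa only [evalSeq, extendZero_val] using this

theorem evalSeq_congr {n : ℕ} (f : Cochain K V W n) {x y : ℕ → V} (h : ∀ k ≤ n, x k = y k) :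
    evalSeq f x = evalSeq f y :=
  congrArg f (funext fun i => h i (Nat.lt_succ_iff.mp i.2))

/-- Degrees such as m + (n + p) and m + n + p give different types; this transports a cochain
between them without changing its values on sequences. -/
theorem CochainSum.exists_of_eq {m n : ℕ} (h : m = n) (f : Cochain K V W m) :
    ∃ g : Cochain K V W n, of m f = of n g ∧ ∀ x, evalSeq g x = evalSeq f x := by
  subst h
  exact ⟨f, rfl, fun _ => rfl⟩

/-- The sequence `(x₀, …, x_{i-1}, v, x_{i+n+1}, …)`. -/
def insertSeq {V : Type*} (i n : ℕ) (x : ℕ → V) (v : V) (j : ℕ) : V :=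
  if j < i then x j else if j = i then v else x (j + n)

theorem insertSeq_nested {V : Type*} {i n k : ℕ} (hk : k ≤ n) (p : ℕ) (x : ℕ → V) (v w : V) :
    insertSeq i n (insertSeq (i + k) p x v) w = insertSeq i (n + p) x w := by
  funext j
  simp only [insertSeq]
  split_ifs <;> first | rfl | omega | exact congrArg x (by omega)

theorem insertSeq_shift {V : Type*} (i k p : ℕ) (x : ℕ → V) (v : V) :
    (fun j => insertSeq (i + k) p x v (i + j)) = insertSeq k p (fun j => x (i + j)) v := by
  funext j
  simp only [insertSeq]
  split_ifs <;> first | rfl | omega | exact congrArg x (by omega)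

theorem insertSeq_comm {V : Type*} {i j : ℕ} (h : i < j) (n p : ℕ) (x : ℕ → V) (v w : V) :
    insertSeq i n (insertSeq (j + n) p x v) w = insertSeq j p (insertSeq i n x w) v := by
  funext k
  simp only [insertSeq]
  split_ifs <;> first | rfl | omega | exact congrArg x (by omega)

theorem insertSeq_add_of_lt {V : Type*} {i j : ℕ} (h : j < i) (p k : ℕ) (x : ℕ → V) (v : V) :
    insertSeq j p x v (i + k) = x (i + p + k) := by
  simp only [insertSeq]
  split_ifs <;> first | omega | exact congrArg x (by omega)

/-- Linearity in the inserted slot allows the signed sum defining an inner circle product to be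
pulled out of `f`. -/
theorem exists_evalSeq_insertSeq_eq {m i : ℕ} (hi : i ≤ m) (f : Cochain K V W m) (n : ℕ)
    (x : ℕ → V) : ∃ φ : V →ₗ[K] W, ∀ v, evalSeq f (insertSeq i n x v) = φ v := by
  refine ⟨f.toLinearMap (fun j => insertSeq i n x 0 j) ⟨i, Nat.lt_succ_iff.mpr hi⟩, fun v => ?_⟩
  rw [MultilinearMap.toLinearMap_apply, evalSeq]
  congr 1
  funext j
  simp only [insertSeq, Function.update_apply, Fin.ext_iff]
  split_ifs <;> first | rfl | omega

end SequenceEvaluation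

/-! ### The pre-Lie identity of the circle product -/

section PreLie

variable {K V : Type*} [Field K] [AddCommGroup V] [Module K V]

theorem evalSeq_partialComp {m n : ℕ} (i : Fin (m + 1)) (f : Cochain K V V m)
    (g : Cochain K V V n) (x : ℕ → V) :
    evalSeq (partialComp i f g) x =
      evalSeq f (insertSeq i n x (evalSeq g fun k => x (i + k))) := by
  rw [evalSeq, partialComp_apply, evalSeq]
  congr 1
  funext j
  simp only [insertArgs, insertSeq, Fin.lt_def, Fin.ext_iff]
  rfl

theorem evalSeq_circ {m n : ℕ} (f : Cochain K V V m) (g : Cochain K V V n) (x : ℕ → V) :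
    evalSeq (circ m n f g) x = ∑ i ∈ Finset.range (m + 1), (-1 : K) ^ (i * n) •
      evalSeq f (insertSeq i n x (evalSeq g fun k => x (i + k))) := by
  rw [Finset.sum_range]
  simp only [← evalSeq_partialComp]
  simp [circ, evalSeq, LinearMap.sum_apply, partialCompₗ]

/-- The sum of the terms of `(f ∘ g) ∘ h` in which `h` is inserted to the left of `g`. -/
def disjointInsertions {m n p : ℕ} (f : Cochain K V V m) (g : Cochain K V V n)
    (h : Cochain K V V p) (x : ℕ → V) : V :=
  ∑ i ∈ Finset.range (m + 1), ∑ j ∈ Finset.range i, (-1 : K) ^ (i * n + j * p) •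
    evalSeq f (insertSeq i n (insertSeq j p x (evalSeq h fun k => x (j + k)))
      (evalSeq g fun k => x (i + p + k)))

/-- A term of (f ∘ g) ∘ h inserts `h` inside `g`, to its left or to its right. The first kind gives
f ∘ (g ∘ h); the other two are exchanged, up to sign, by swapping `g` and `h`. -/
theorem evalSeq_circ_circ {m n p : ℕ} (f : Cochain K V V m) (g : Cochain K V V n)
    (h : Cochain K V V p) (x : ℕ → V) :
    evalSeq (circ (m + n) p (circ m n f g) h) x =
      evalSeq (circ m (n + p) f (circ n p g h)) x +
        (disjointInsertions f g h x + (-1 : K) ^ (n * p) • disjointInsertions f h g x) := by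
  let t : ℕ → ℕ → V := fun i j => (-1 : K) ^ (i * n + j * p) •
    evalSeq f (insertSeq i n (insertSeq j p x (evalSeq h fun k => x (j + k)))
      (evalSeq g fun k => insertSeq j p x (evalSeq h fun k => x (j + k)) (i + k)))
  have hL : evalSeq (circ (m + n) p (circ m n f g) h) x =
      ∑ i ∈ Finset.range (m + 1), ∑ j ∈ Finset.range (m + n + 1), t i j := by
    rw [evalSeq_circ, Finset.sum_comm]
    refine Finset.sum_congr rfl fun j _ => ?_
    rw [evalSeq_circ, Finset.smul_sum]
    refine Finset.sum_congr rfl fun i _ => ?_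
    rw [smul_smul, ← pow_add, add_comm]
  -- With `g` at position `i` of `f`, the block of `g` occupies the positions i, …, i + n of the
  -- composite; `j` lies before, in or after it.
  have hsplit : ∀ i ∈ Finset.range (m + 1), ∑ j ∈ Finset.range (m + n + 1), t i j =
      ∑ j ∈ Finset.range i, t i j + ∑ k ∈ Finset.range (n + 1), t i (i + k) +
        ∑ j ∈ Finset.Ico (i + 1) (m + 1), t i (j + n) := by
    intro i hi
    rw [Finset.mem_range] at hi
    rw [show m + n + 1 = i + (n + 1) + (m - i) by omega, Finset.sum_range_add,
      Finset.sum_range_add, Finset.sum_Ico_eq_sum_range, show m + 1 - (i + 1) = m - i by omega]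
    congr 1
    refine Finset.sum_congr rfl fun k _ => ?_
    congr 1
    omega
  have h₁ : ∑ i ∈ Finset.range (m + 1), ∑ j ∈ Finset.range i, t i j =
      disjointInsertions f g h x := by
    refine Finset.sum_congr rfl fun i _ => Finset.sum_congr rfl fun j hj => ?_
    simp only [t, insertSeq_add_of_lt (Finset.mem_range.mp hj)]
  have h₂ : ∑ i ∈ Finset.range (m + 1), ∑ k ∈ Finset.range (n + 1), t i (i + k) =
      evalSeq (circ m (n + p) f (circ n p g h)) x := by
    rw [evalSeq_circ]
    refine Finset.sum_congr rfl fun i hi => ?_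
    rw [evalSeq_circ]
    obtain ⟨φ, hφ⟩ := exists_evalSeq_insertSeq_eq (Nat.lt_succ_iff.mp (Finset.mem_range.mp hi))
      f (n + p) x
    rw [hφ, map_sum, Finset.smul_sum]
    refine Finset.sum_congr rfl fun k hk => ?_
    rw [map_smul, ← hφ]
    simp only [t, insertSeq_shift, insertSeq_nested (Nat.lt_succ_iff.mp (Finset.mem_range.mp hk)),
      smul_smul, ← pow_add, add_assoc]
    congr 2
    ring
  have h₃ : ∑ i ∈ Finset.range (m + 1), ∑ j ∈ Finset.Ico (i + 1) (m + 1), t i (j + n) =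
      (-1 : K) ^ (n * p) • disjointInsertions f h g x := by
    -- The roles are exchanged by making the position of `h`, now the larger one, the outer index;
    -- its shift by `n` produces (-1)^{np}.
    rw [disjointInsertions, Finset.smul_sum, Finset.sum_comm' (t' := Finset.range (m + 1))
      (s' := fun j => Finset.range j)]
    · refine Finset.sum_congr rfl fun j _ => ?_
      rw [Finset.smul_sum]
      refine Finset.sum_congr rfl fun i hi => ?_
      have hij := Finset.mem_range.mp hi
      simp only [t]
      rw [insertSeq_comm hij, smul_smul, ← pow_add,
        evalSeq_congr g (y := fun k => x (i + k))]
      · congr 2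
        ring
      · intro k hk
        simp only [insertSeq]
        rw [if_pos (by omega)]
    · intro i j
      simp only [Finset.mem_range, Finset.mem_Ico]
      omega
  rw [hL, Finset.sum_congr rfl hsplit, Finset.sum_add_distrib, Finset.sum_add_distrib, h₁, h₂, h₃]
  abel

/-- The circle product on the direct sum. -/
noncomputable def circSum (K V : Type*) [Field K] [AddCommGroup V] [Module K V] :
    CochainSum K V V →ₗ[K] CochainSum K V V →ₗ[K] CochainSum K V V :=
  CochainSum.desc fun m =>
    (CochainSum.desc fun n => ((circ m n).compr₂ (CochainSum.of (m + n))).flip).flip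

theorem circSum_of_of {m n : ℕ} (f : Cochain K V V m) (g : Cochain K V V n) :
    circSum K V (CochainSum.of m f) (CochainSum.of n g) =
      CochainSum.of (m + n) (circ m n f g) := by
  simp [circSum, CochainSum.desc_of]

theorem gerstenhaberBracket_of_of {m n : ℕ} (f : Cochain K V V m) (g : Cochain K V V n) :
    gerstenhaberBracket K V (CochainSum.of m f) (CochainSum.of n g) =
      circSum K V (CochainSum.of m f) (CochainSum.of n g) -
        (-1 : K) ^ (m * n) • circSum K V (CochainSum.of n g) (CochainSum.of m f) := by
  rw [circSum_of_of, circSum_of_of]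
  simp [gerstenhaberBracket, CochainSum.desc_of, homogeneousBracket]

/-- The graded right pre-Lie identity. -/
theorem circSum_preLie {m n p : ℕ} (f : Cochain K V V m) (g : Cochain K V V n)
    (h : Cochain K V V p) :
    circSum K V (circSum K V (.of m f) (.of n g)) (.of p h) -
        circSum K V (.of m f) (circSum K V (.of n g) (.of p h)) =
      (-1 : K) ^ (n * p) • (circSum K V (circSum K V (.of m f) (.of p h)) (.of n g) -
        circSum K V (.of m f) (circSum K V (.of p h) (.of n g))) := by
  simp only [circSum_of_of]
  obtain ⟨u₁, h₁, e₁⟩ := CochainSum.exists_of_eq (by omega : m + (n + p) = m + n + p)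
    (circ m (n + p) f (circ n p g h))
  obtain ⟨u₂, h₂, e₂⟩ := CochainSum.exists_of_eq (by omega : m + p + n = m + n + p)
    (circ (m + p) n (circ m p f h) g)
  obtain ⟨u₃, h₃, e₃⟩ := CochainSum.exists_of_eq (by omega : m + (p + n) = m + n + p)
    (circ m (p + n) f (circ p n h g))
  rw [h₁, h₂, h₃, ← map_sub, ← map_sub, ← map_smul]
  congr 1
  refine evalSeq_injective fun x => ?_
  change evalSeq (circ (m + n) p (circ m n f g) h) x - evalSeq u₁ x =
    (-1 : K) ^ (n * p) • (evalSeq u₂ x - evalSeq u₃ x)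
  rw [e₁, e₂, e₃, evalSeq_circ_circ, evalSeq_circ_circ, add_sub_cancel_left,
    add_sub_cancel_left, smul_add, smul_smul, mul_comm p n, ← mul_pow, neg_one_mul, neg_neg,
    one_pow, one_smul, add_comm]

end PreLie

/-! ### The Gerstenhaber bracket as a graded Lie bracket -/

section CochainGrading

variable {K V W : Type*} [Field K] [AddCommGroup V] [Module K V] [AddCommGroup W] [Module K W]

theorem of_mem_cochainGrading {n : ℕ} (f : Cochain K V W n) :
    CochainSum.of n f ∈ cochainGrading K V W n := ⟨f, rfl⟩

theorem eq_zero_or_exists_of_mem_cochainGrading {a : ℤ} {x : CochainSum K V W}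
    (hx : x ∈ cochainGrading K V W a) :
    x = 0 ∨ ∃ (n : ℕ) (f : Cochain K V W n), a = n ∧ x = CochainSum.of n f := by
  cases a with
  | ofNat n =>
    obtain ⟨f, rfl⟩ := hx
    exact Or.inr ⟨n, f, rfl, rfl⟩
  | negSucc n => exact Or.inl ((Submodule.mem_bot K).mp hx)

theorem CochainSum.induction_on {p : CochainSum K V W → Prop} (x : CochainSum K V W)
    (zero : p 0) (of : ∀ (n : ℕ) (f : Cochain K V W n), p (of n f))
    (add : ∀ x y, p x → p y → p (x + y)) : p x :=
  DirectSum.induction_on x zero of add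

theorem CochainSum.of_injective (n : ℕ) :
    Function.Injective (of n : Cochain K V W n →ₗ[K] CochainSum K V W) :=
  DirectSum.of_injective n

theorem isInternal_cochainGrading : DirectSum.IsInternal (cochainGrading K V W) := by
  classical
  rw [DirectSum.isInternal_submodule_iff_iSupIndep_and_iSup_eq_top]
  constructor
  · intro a
    rw [Submodule.disjoint_def]
    intro x hx hx'
    rcases eq_zero_or_exists_of_mem_cochainGrading hx with rfl | ⟨n, f, rfl, rfl⟩
    · rfl
    -- The projection to degree `n` kills all other degrees and fixes `of n f`.
    let φ : CochainSum K V W →ₗ[K] CochainSum K V W :=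
      CochainSum.desc fun k => if k = n then CochainSum.of k else 0
    have hφ : (⨆ j, ⨆ _ : j ≠ (n : ℤ), cochainGrading K V W j) ≤ LinearMap.ker φ := by
      refine iSup₂_le fun j hj y hy => ?_
      rcases eq_zero_or_exists_of_mem_cochainGrading hy with rfl | ⟨k, g, rfl, rfl⟩
      · exact zero_mem _
      · have : k ≠ n := fun h => hj (by rw [h])
        simp [φ, CochainSum.desc_of, this]
    have := LinearMap.mem_ker.mp (hφ hx')
    simpa [φ, CochainSum.desc_of] using this
  · refine eq_top_iff.mpr fun x _ => ?_
    induction x using CochainSum.induction_on with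
    | zero => exact zero_mem _
    | of n f => exact Submodule.mem_iSup_of_mem (n : ℤ) (of_mem_cochainGrading f)
    | add x y hx hy => exact add_mem (hx trivial) (hy trivial)

end CochainGrading

section GradedLie

variable {K V : Type*} [Field K] [AddCommGroup V] [Module K V]

theorem negOnePow_mul_smul (m n : ℕ) (x : CochainSum K V V) :
    ((m : ℤ) * n).negOnePow • x = (-1 : K) ^ (m * n) • x := by
  rw [← Nat.cast_mul, Int.negOnePow_def, zpow_natCast]
  rcases Nat.even_or_odd (m * n) with h | h
  · rw [h.neg_one_pow, h.neg_one_pow, one_smul, one_smul]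
  · rw [h.neg_one_pow, h.neg_one_pow, ← neg_intUnits_smul, one_smul, neg_one_smul]

theorem gerstenhaberBracket_mem {m n : ℕ} {x y : CochainSum K V V}
    (hx : x ∈ cochainGrading K V V m) (hy : y ∈ cochainGrading K V V n) :
    gerstenhaberBracket K V x y ∈ cochainGrading K V V ((m + n : ℕ) : ℤ) := by
  obtain ⟨f, rfl⟩ := hx
  obtain ⟨g, rfl⟩ := hy
  rw [gerstenhaberBracket_of_of, circSum_of_of, circSum_of_of]
  refine sub_mem (of_mem_cochainGrading _) (Submodule.smul_mem _ _ ?_)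
  rw [add_comm m n]
  exact of_mem_cochainGrading _

theorem gerstenhaberBracket_eq {m n : ℕ} {x y : CochainSum K V V}
    (hx : x ∈ cochainGrading K V V m) (hy : y ∈ cochainGrading K V V n) :
    gerstenhaberBracket K V x y =
      circSum K V x y - (-1 : K) ^ (m * n) • circSum K V y x := by
  obtain ⟨f, rfl⟩ := hx
  obtain ⟨g, rfl⟩ := hy
  exact gerstenhaberBracket_of_of f g

theorem gerstenhaberBracket_jacobi {m n p : ℕ} (f : Cochain K V V m) (g : Cochain K V V n)
    (h : Cochain K V V p) :
    gerstenhaberBracket K V (.of m f) (gerstenhaberBracket K V (.of n g) (.of p h)) =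
      gerstenhaberBracket K V (gerstenhaberBracket K V (.of m f) (.of n g)) (.of p h) +
        (-1 : K) ^ (m * n) •
          gerstenhaberBracket K V (.of n g) (gerstenhaberBracket K V (.of m f) (.of p h)) := by
  have hf := of_mem_cochainGrading f
  have hg := of_mem_cochainGrading g
  have hh := of_mem_cochainGrading h
  have h₁ := circSum_preLie f g h
  have h₂ := circSum_preLie g f h
  have h₃ := circSum_preLie h f g
  rw [gerstenhaberBracket_eq hf (gerstenhaberBracket_mem hg hh),
    gerstenhaberBracket_eq (gerstenhaberBracket_mem hf hg) hh,
    gerstenhaberBracket_eq hg (gerstenhaberBracket_mem hf hh),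
    gerstenhaberBracket_eq hg hh, gerstenhaberBracket_eq hf hg, gerstenhaberBracket_eq hf hh]
  simp only [map_sub, map_smul, LinearMap.sub_apply, LinearMap.smul_apply, mul_add, add_mul,
    pow_add, mul_comm n m]
  have hs := neg_one_pow_eq_or K (m * n)
  have ht := neg_one_pow_eq_or K (n * p)
  have hr := neg_one_pow_eq_or K (m * p)
  generalize (-1 : K) ^ (m * n) = s at *
  generalize (-1 : K) ^ (n * p) = t at *
  generalize (-1 : K) ^ (m * p) = r at *
  -- The difference of the two sides is -h₁ + s·h₂ - tr·h₃; the sign s is split into cases because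
  -- s² occurs.
  rcases hs with rfl | rfl
  · linear_combination (norm := module) (-1 : K) • h₁ + (1 : K) • h₂ - (t * r) • h₃
  · linear_combination (norm := module) (-1 : K) • h₁ + (-1 : K) • h₂ - (t * r) • h₃

theorem isGradedLieAlgebra_gerstenhaberBracket :
    IsGradedLieAlgebra (cochainGrading K V V) (gerstenhaberBracket K V) where
  isInternal := isInternal_cochainGrading
  bracket_mem a b x y hx hy := by
    rcases eq_zero_or_exists_of_mem_cochainGrading hx with rfl | ⟨m, f, rfl, rfl⟩
    · simp
    rcases eq_zero_or_exists_of_mem_cochainGrading hy with rfl | ⟨n, g, rfl, rfl⟩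
    · simp
    exact_mod_cast gerstenhaberBracket_mem hx hy
  antisymm a b x y hx hy := by
    rcases eq_zero_or_exists_of_mem_cochainGrading hx with rfl | ⟨m, f, rfl, rfl⟩
    · simp
    rcases eq_zero_or_exists_of_mem_cochainGrading hy with rfl | ⟨n, g, rfl, rfl⟩
    · simp
    rw [negOnePow_mul_smul, gerstenhaberBracket_of_of, gerstenhaberBracket_of_of, smul_sub,
      smul_smul, mul_comm n m, ← mul_pow, neg_one_mul, neg_neg, one_pow, one_smul, neg_sub]
  jacobi a b c x y z hx hy hz := by
    rcases eq_zero_or_exists_of_mem_cochainGrading hx with rfl | ⟨m, f, rfl, rfl⟩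
    · simp
    rcases eq_zero_or_exists_of_mem_cochainGrading hy with rfl | ⟨n, g, rfl, rfl⟩
    · simp
    rcases eq_zero_or_exists_of_mem_cochainGrading hz with rfl | ⟨p, h, rfl, rfl⟩
    · simp
    rw [negOnePow_mul_smul, gerstenhaberBracket_jacobi]

end GradedLie

/-! ### Coefficients, and brackets with endomorphisms and bilinear maps -/

namespace CochainSum

variable {K V W : Type*} [Field K] [AddCommGroup V] [Module K V] [AddCommGroup W] [Module K W]

/-- The component of degree `n`. -/
noncomputable def coeff (n : ℕ) : CochainSum K V W →ₗ[K] Cochain K V W n :=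
  DirectSum.component K ℕ (Cochain K V W) n

theorem ext_coeff {x y : CochainSum K V W} (h : ∀ n, coeff n x = coeff n y) : x = y :=
  DirectSum.ext_component K h

theorem coeff_of_self (n : ℕ) (f : Cochain K V W n) : coeff n (of n f) = f :=
  DirectSum.component.lof_self K n f

theorem coeff_of_of_ne {m n : ℕ} (h : m ≠ n) (f : Cochain K V W m) : coeff n (of m f) = 0 := by
  refine (DirectSum.component.of K n m f).trans ?_
  rw [dif_neg h]

theorem coeff_desc_of_comp {V' W' : Type*} [AddCommGroup V'] [Module K V'] [AddCommGroup W']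
    [Module K W'] (φ : (n : ℕ) → Cochain K V W n →ₗ[K] Cochain K V' W' n) (n : ℕ)
    (x : CochainSum K V W) :
    coeff n (desc (fun k => of k ∘ₗ φ k) x) = φ n (coeff n x) := by
  suffices h : coeff n ∘ₗ desc (fun k => of k ∘ₗ φ k) = φ n ∘ₗ coeff n from
    LinearMap.congr_fun h x
  refine hom_ext fun m f => ?_
  rw [LinearMap.comp_apply, LinearMap.comp_apply, desc_of, LinearMap.comp_apply]
  by_cases h : m = n
  · subst h
    rw [coeff_of_self, coeff_of_self]
  · rw [coeff_of_of_ne h, coeff_of_of_ne h, map_zero]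

end CochainSum

section LinearAndBilinearCochains

variable {K V : Type*} [Field K] [AddCommGroup V] [Module K V]

/-- A linear endomorphism as a cochain of degree `0`. -/
def linCochain (t : V →ₗ[K] V) : Cochain K V V 0 :=
  MultilinearMap.ofSubsingleton K V V (0 : Fin 1) t

theorem evalSeq_linCochain (t : V →ₗ[K] V) (x : ℕ → V) : evalSeq (linCochain t) x = t (x 0) := rfl

/-- The action `[φ, t]` of an endomorphism `t` on a bilinear map `φ`. -/
def bilinBracket (φ : V →ₗ[K] V →ₗ[K] V) (t : V →ₗ[K] V) : V →ₗ[K] V →ₗ[K] V :=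
  φ.compl₁₂ t LinearMap.id + φ.compl₁₂ LinearMap.id t - φ.compr₂ t

theorem bilinBracket_apply (φ : V →ₗ[K] V →ₗ[K] V) (t : V →ₗ[K] V) (x y : V) :
    bilinBracket φ t x y = φ (t x) y + φ x (t y) - t (φ x y) := rfl

theorem bilinCochain_add (φ ψ : V →ₗ[K] V →ₗ[K] V) :
    bilinCochain (φ + ψ) = bilinCochain φ + bilinCochain ψ := by
  rw [bilinCochain, bilinCochain, bilinCochain, ← map_add]
  rfl

theorem bilinCochain_smul (c : K) (φ : V →ₗ[K] V →ₗ[K] V) :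
    bilinCochain (c • φ) = c • bilinCochain φ := by
  rw [bilinCochain, bilinCochain, ← map_smul]
  rfl

theorem bilinCochain_mem (φ : V →ₗ[K] V →ₗ[K] V) :
    bilinCochain φ ∈ cochainGrading K V V 1 :=
  of_mem_cochainGrading (n := 1) _

theorem gerstenhaberBracket_bilinCochain_linCochain (φ : V →ₗ[K] V →ₗ[K] V) (t : V →ₗ[K] V) :
    gerstenhaberBracket K V (bilinCochain φ) (CochainSum.of 0 (linCochain t)) =
      bilinCochain (bilinBracket φ t) := by
  simp only [bilinCochain, gerstenhaberBracket_of_of, circSum_of_of]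
  rw [mul_zero, pow_zero, one_smul, ← map_sub]
  congr 1
  refine evalSeq_injective fun x => ?_
  rw [show ∀ f g : Cochain K V V 1, evalSeq (f - g) x = evalSeq f x - evalSeq g x
    from fun _ _ => rfl]
  refine (congrArg₂ _ (evalSeq_circ _ _ x) (evalSeq_circ _ _ x)).trans ?_
  simp [Finset.sum_range_succ, evalSeq, insertSeq, linCochain, bilinBracket_apply]

/-- The circle square of the product is the associator (xy)z - x(yz). -/
theorem gerstenhaberBracket_bilinCochain_mul {A : Type*} [NonUnitalRing A] [Module K A]
    [IsScalarTower K A A] [SMulCommClass K A A] :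
    gerstenhaberBracket K A (bilinCochain (LinearMap.mul K A)) (bilinCochain (LinearMap.mul K A)) =
      0 := by
  have h : ∀ f : Cochain K A A 1, (∀ x : ℕ → A, evalSeq f x = x 0 * x 1) → circ 1 1 f f = 0 := by
    intro f hf
    refine evalSeq_injective fun x => ?_
    rw [evalSeq_circ]
    simp only [hf]
    simp [Finset.sum_range_succ, insertSeq, evalSeq, mul_assoc]
  rw [bilinCochain, gerstenhaberBracket_of_of, circSum_of_of, h _ fun x => rfl]
  simp

/-- The action `[t, f]` of an endomorphism `t` on a cochain `f`. -/
def endAction (t : V →ₗ[K] V) (n : ℕ) : Cochain K V V n →ₗ[K] Cochain K V V n where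
  toFun f := t.compMultilinearMap f - circ n 0 f (linCochain t)
  map_add' f g := by
    refine MultilinearMap.ext fun x => ?_
    simp only [map_add, sub_apply, add_apply, LinearMap.add_apply,
      LinearMap.compMultilinearMap_apply]
    exact add_sub_add_comm _ _ _ _
  map_smul' c f := by
    refine MultilinearMap.ext fun x => ?_
    simp only [map_smul, sub_apply, smul_apply, LinearMap.smul_apply,
      LinearMap.compMultilinearMap_apply, RingHom.id_apply]
    exact (smul_sub _ _ _).symm

theorem endAction_apply (t : V →ₗ[K] V) {n : ℕ} (f : Cochain K V V n) (x : Fin (n + 1) → V) :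
    endAction t n f x = t (f x) - ∑ i, f (Function.update x i (t (x i))) := by
  have h : circ n 0 f (linCochain t) x = ∑ i, f (Function.update x i (t (x i))) := by
    rw [← funext (extendZero_val x)]
    refine (evalSeq_circ f (linCochain t) (extendZero x)).trans ?_
    rw [Finset.sum_range]
    refine Finset.sum_congr rfl fun i _ => ?_
    rw [mul_zero, pow_zero, one_smul]
    refine congrArg f (funext fun j => ?_)
    simp only [insertSeq, Function.update_apply, Fin.ext_iff, evalSeq_linCochain, add_zero]
    split_ifs <;> first | rfl | omega
  rw [← h]
  rfl

theorem gerstenhaberBracket_linCochain (t : V →ₗ[K] V) :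
    gerstenhaberBracket K V (CochainSum.of 0 (linCochain t)) =
      CochainSum.desc fun n => CochainSum.of n ∘ₗ endAction t n := by
  refine CochainSum.hom_ext fun n f => ?_
  rw [CochainSum.desc_of, LinearMap.comp_apply, gerstenhaberBracket_of_of, circSum_of_of,
    circSum_of_of, zero_mul, pow_zero, one_smul]
  obtain ⟨u, h, e⟩ := CochainSum.exists_of_eq (zero_add n) (circ 0 n (linCochain t) f)
  rw [h]
  refine (map_sub (CochainSum.of n) u (circ n 0 f (linCochain t))).symm.trans ?_
  refine congrArg (fun w => CochainSum.of n (w - circ n 0 f (linCochain t))) ?_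
  refine evalSeq_injective fun x => ?_
  rw [e, evalSeq_circ]
  simp [evalSeq, insertSeq, linCochain]

end LinearAndBilinearCochains

section IteratedBracket

variable {K L : Type*} [Field K] [AddCommGroup L] [Module K L]

theorem iteratedBracket_succ (br : L →ₗ[K] L →ₗ[K] L) (a : L) (k : ℕ) (x : Fin (k + 1) → L) :
    iteratedBracket br a (k + 1) x =
      br (iteratedBracket br a k fun i => x i.castSucc) (x (Fin.last k)) := rfl

theorem iteratedBracket_zero (br : L →ₗ[K] L →ₗ[K] L) (a : L) (x : Fin 0 → L) :
    iteratedBracket br a 0 x = a := rfl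

theorem iteratedBracket_add (br : L →ₗ[K] L →ₗ[K] L) (a b : L) (k : ℕ) (x : Fin k → L) :
    iteratedBracket br (a + b) k x = iteratedBracket br a k x + iteratedBracket br b k x := by
  induction k with
  | zero => rfl
  | succ k ih => rw [iteratedBracket_succ, ih, map_add, LinearMap.add_apply]; rfl

end IteratedBracket

/-! ### The V-data of a quasi-twilled algebra -/

namespace QuasiTwilledAlgebra

variable {K 𝒜 : Type*} [Field K] [NonUnitalRing 𝒜] [Module K 𝒜]
  [IsScalarTower K 𝒜 𝒜] [SMulCommClass K 𝒜 𝒜] (T : QuasiTwilledAlgebra K 𝒜)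

theorem projA_add_projA' (x : 𝒜) : (T.projA x : 𝒜) + T.projA' x = x :=
  Submodule.projection_add_projection_eq_self T.isCompl x

@[simp]
theorem projA_coe (x : T.A) : T.projA (x : 𝒜) = x :=
  Submodule.projectionOnto_apply_left T.isCompl x

@[simp]
theorem projA_coe' (u : T.A') : T.projA (u : 𝒜) = 0 :=
  Submodule.projectionOnto_apply_right T.isCompl u

@[simp]
theorem projA'_coe (u : T.A') : T.projA' (u : 𝒜) = u :=
  Submodule.projectionOnto_apply_left T.isCompl.symm u

@[simp]
theorem projA'_coe' (x : T.A) : T.projA' (x : 𝒜) = 0 :=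
  Submodule.projectionOnto_apply_right T.isCompl.symm x

theorem projA_eq_zero_iff {x : 𝒜} : T.projA x = 0 ↔ x ∈ T.A' :=
  Submodule.projectionOnto_apply_eq_zero_iff T.isCompl

/-- Of the eight possible components, the one from A' ⊗ A' to A is missing because A' is a
subalgebra. -/
theorem Ω_eq : T.Ω = T.πL + T.ξL + T.ηL + T.βL + T.ρL + T.μL + T.θL := by
  simp only [Ω, πL, ξL, ηL, βL, ρL, μL, θL, ← bilinCochain_add]
  congr 1
  refine LinearMap.ext₂ fun x y => ?_
  have hx := T.projA_add_projA' x
  have hy := T.projA_add_projA' y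
  have hβ : (T.projA ((T.projA' x : 𝒜) * T.projA' y) : 𝒜) = 0 := by
    rw [T.projA_eq_zero_iff.mpr (T.mul_mem _ (T.projA' x).2 _ (T.projA' y).2),
      ZeroMemClass.coe_zero]
  have h₁ := T.projA_add_projA' ((T.projA x : 𝒜) * T.projA y)
  have h₂ := T.projA_add_projA' ((T.projA x : 𝒜) * T.projA' y)
  have h₃ := T.projA_add_projA' ((T.projA' x : 𝒜) * T.projA y)
  have h₄ := T.projA_add_projA' ((T.projA' x : 𝒜) * T.projA' y)
  rw [hβ, zero_add] at h₄
  have h : x * y = (T.projA x : 𝒜) * T.projA y + (T.projA x : 𝒜) * T.projA' y +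
      (T.projA' x : 𝒜) * T.projA y + (T.projA' x : 𝒜) * T.projA' y := by
    conv_lhs => rw [← hx, ← hy]
    rw [add_mul, mul_add, mul_add, add_assoc (_ + _)]
  simp only [LinearMap.mul_apply', LinearMap.add_apply, LinearMap.compr₂_apply,
    LinearMap.compl₁₂_apply, π, ξ, η, β, ρ, μ, θ, Submodule.subtype_apply, h₄]
  rw [h]
  nth_rw 1 [← h₁, ← h₂, ← h₃]
  abel

theorem P_eq_desc :
    T.P = CochainSum.desc fun n => CochainSum.of n ∘ₗ (T.lift n ∘ₗ T.component n) := by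
  refine CochainSum.hom_ext fun n f => ?_
  simp only [P, liftSum, componentSum, LinearMap.comp_apply, CochainSum.desc_of]

theorem P_of (n : ℕ) (f : Cochain K 𝒜 𝒜 n) :
    T.P (CochainSum.of n f) = CochainSum.of n (T.lift n (T.component n f)) := by
  rw [P_eq_desc, CochainSum.desc_of]
  rfl

theorem liftSum_of (n : ℕ) (f : Cochain K T.A' T.A n) :
    T.liftSum (CochainSum.of n f) = CochainSum.of n (T.lift n f) := by
  rw [liftSum, CochainSum.desc_of]
  rfl

theorem P_P (x : T.L) : T.P (T.P x) = T.P x :=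
  congrArg T.liftSum (T.componentSum_liftSum _)

theorem P_of_mem {x : T.L} (hx : x ∈ T.F) : T.P x = x := by
  obtain ⟨c, rfl⟩ := hx
  exact congrArg T.liftSum (T.componentSum_liftSum c)

theorem P_mem_gradingL (k : ℤ) (x : T.L) (hx : x ∈ T.gradingL k) : T.P x ∈ T.gradingL k := by
  rcases eq_zero_or_exists_of_mem_cochainGrading hx with rfl | ⟨n, f, rfl, rfl⟩
  · rw [map_zero]
    exact zero_mem _
  · rw [P_of]
    exact of_mem_cochainGrading _

theorem F_homogeneous : T.F = ⨆ k : ℤ, T.F ⊓ T.gradingL k := by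
  refine le_antisymm ?_ (iSup_le fun k => inf_le_left)
  rintro _ ⟨c, rfl⟩
  induction c using CochainSum.induction_on with
  | zero => rw [map_zero]; exact zero_mem _
  | of n f =>
    refine Submodule.mem_iSup_of_mem (n : ℤ) ⟨LinearMap.mem_range_self _ _, ?_⟩
    rw [liftSum_of]
    exact of_mem_cochainGrading _
  | add x y hx hy => rw [map_add]; exact add_mem hx hy

theorem ker_P_homogeneous : LinearMap.ker T.P = ⨆ k : ℤ, LinearMap.ker T.P ⊓ T.gradingL k := by
  refine le_antisymm (fun x hx => ?_) (iSup_le fun k => inf_le_left)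
  -- Being in the kernel does not pass to the summands in an induction; `y - T.P y` is additive in
  -- `y` and equals `y` on the kernel.
  suffices h : ∀ y : T.L, y - T.P y ∈ ⨆ k : ℤ, LinearMap.ker T.P ⊓ T.gradingL k by
    simpa [LinearMap.mem_ker.mp hx] using h x
  intro y
  induction y using CochainSum.induction_on with
  | zero => simp
  | of n f =>
    refine Submodule.mem_iSup_of_mem (n : ℤ) ⟨?_, ?_⟩
    · rw [SetLike.mem_coe, LinearMap.mem_ker, map_sub, P_P, sub_self]
    · exact sub_mem (of_mem_cochainGrading f) (T.P_mem_gradingL _ _ (of_mem_cochainGrading f))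
  | add x y hx hy =>
    rw [map_add, add_sub_add_comm]
    exact add_mem hx hy

theorem component_eq_zero_iff {n : ℕ} {f : Cochain K 𝒜 𝒜 n} :
    T.component n f = 0 ↔ ∀ x : ℕ → 𝒜, (∀ k, x k ∈ T.A') → evalSeq f x ∈ T.A' := by
  constructor
  · intro h x hx
    exact T.projA_eq_zero_iff.mp (MultilinearMap.congr_fun h fun i => ⟨x i, hx i⟩)
  · refine fun h => MultilinearMap.ext fun u => T.projA_eq_zero_iff.mpr ?_
    have := h (extendZero fun i => (u i : 𝒜)) fun k => by
      unfold extendZero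
      split_ifs
      · exact (u _).2
      · exact zero_mem _
    simp only [evalSeq, extendZero_val] at this
    exact this

theorem component_lift {n : ℕ} (f : Cochain K T.A' T.A n) : T.component n (T.lift n f) = f := by
  refine MultilinearMap.ext fun u => ?_
  change T.projA (f fun i => T.projA' (u i : 𝒜) : T.A) = f u
  simp only [projA_coe, projA'_coe]

/-- Cochains that map tensors of A' into A' are closed under insertion. -/
theorem component_circ_eq_zero {m n : ℕ} {f : Cochain K 𝒜 𝒜 m} {g : Cochain K 𝒜 𝒜 n}
    (hf : T.component m f = 0) (hg : T.component n g = 0) :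
    T.component (m + n) (circ m n f g) = 0 := by
  rw [component_eq_zero_iff] at hf hg ⊢
  intro x hx
  rw [evalSeq_circ]
  refine sum_mem fun i _ => Submodule.smul_mem _ _ (hf _ fun k => ?_)
  unfold insertSeq
  split_ifs
  · exact hx _
  · exact hg _ fun k => hx _
  · exact hx _

/-- The inner cochain takes values in A, where the outer one vanishes. -/
theorem circ_lift_lift {m n : ℕ} (f : Cochain K T.A' T.A m) (g : Cochain K T.A' T.A n) :
    circ m n (T.lift m f) (T.lift n g) = 0 := by
  refine evalSeq_injective fun x => ?_
  rw [evalSeq_circ]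
  refine Finset.sum_eq_zero fun i hi => smul_eq_zero_of_right _ ?_
  have h : f (fun j : Fin (m + 1) => T.projA'
      (insertSeq i n x (evalSeq (T.lift n g) fun k => x (i + k)) j)) = 0 := by
    refine f.map_coord_zero (⟨i, Finset.mem_range.mp hi⟩ : Fin (m + 1)) ?_
    simp only [insertSeq, lt_self_iff_false, if_false, if_true]
    exact T.projA'_coe' _
  exact congrArg Subtype.val h

theorem bracket_eq_zero_of_mem_F {x y : T.L} (hx : x ∈ T.F) (hy : y ∈ T.F) :
    T.bracket x y = 0 := by
  obtain ⟨c, rfl⟩ := hx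
  obtain ⟨c', rfl⟩ := hy
  induction c using CochainSum.induction_on with
  | zero => simp
  | add a b ha hb => rw [map_add, map_add, LinearMap.add_apply, ha, hb, add_zero]
  | of m f =>
    induction c' using CochainSum.induction_on with
    | zero => simp
    | add a b ha hb => rw [map_add, map_add, ha, hb, add_zero]
    | of n g =>
      rw [liftSum_of, liftSum_of, bracket, gerstenhaberBracket_of_of, circSum_of_of,
        circSum_of_of, circ_lift_lift, circ_lift_lift]
      simp

theorem P_bracket_eq_zero {x y : T.L} (hx : T.P x = 0) (hy : T.P y = 0) :
    T.P (T.bracket x y) = 0 := by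
  suffices h : ∀ x y : T.L, T.P (T.bracket (x - T.P x) (y - T.P y)) = 0 by
    simpa [hx, hy] using h x y
  clear hx hy x y
  intro x y
  induction x using CochainSum.induction_on with
  | zero => simp
  | add a b ha hb =>
    rw [map_add T.P, add_sub_add_comm, map_add T.bracket, LinearMap.add_apply, map_add, ha, hb,
      add_zero]
  | of m f =>
    induction y using CochainSum.induction_on with
    | zero => simp
    | add a b ha hb =>
      rw [map_add T.P, add_sub_add_comm, map_add (T.bracket _), map_add, ha, hb, add_zero]
    | of n g =>
      have hc : ∀ (k : ℕ) (h : Cochain K 𝒜 𝒜 k),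
          T.component k (h - T.lift k (T.component k h)) = 0 := by
        intro k h
        rw [map_sub, component_lift, sub_self]
      rw [P_of, P_of, ← map_sub, ← map_sub, bracket, gerstenhaberBracket_of_of, circSum_of_of,
        circSum_of_of, map_sub, map_smul, P_of, P_of, component_circ_eq_zero T (hc m f) (hc n g),
        component_circ_eq_zero T (hc n g) (hc m f)]
      simp

theorem P_Ω : T.P T.Ω = 0 := by
  rw [Ω, bilinCochain, P_of, T.component_eq_zero_iff.mpr, map_zero, map_zero]
  exact fun x hx => T.mul_mem _ (hx 0) _ (hx 1)

theorem isVData : IsVData T.gradingL T.bracket T.F T.P T.Ω where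
  gradedLie := isGradedLieAlgebra_gerstenhaberBracket
  subalgebra := ⟨T.F_homogeneous, fun x hx y hy => by
    rw [T.bracket_eq_zero_of_mem_F hx hy]; exact zero_mem _⟩
  abelian _ hx _ hy := T.bracket_eq_zero_of_mem_F hx hy
  proj := LinearMap.ext T.P_P
  range_proj := by
    refine le_antisymm ?_ fun x hx => ⟨x, T.P_of_mem hx⟩
    rintro _ ⟨x, rfl⟩
    exact T.P_mem x
  ker_proj := ⟨T.ker_P_homogeneous, fun _ hx _ hy => T.P_bracket_eq_zero hx hy⟩
  degree_one := bilinCochain_mem _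
  square_zero := gerstenhaberBracket_bilinCochain_mul
  mem_ker := T.P_Ω

end QuasiTwilledAlgebra

/-! ### The weight grading and the formulas for the operations -/

namespace QuasiTwilledAlgebra

variable {K 𝒜 : Type*} [Field K] [NonUnitalRing 𝒜] [Module K 𝒜]
  [IsScalarTower K 𝒜 𝒜] [SMulCommClass K 𝒜 𝒜] (T : QuasiTwilledAlgebra K 𝒜)

/-- The projection of `𝒜` onto `A`, as an endomorphism of `𝒜`. -/
noncomputable def endA : 𝒜 →ₗ[K] 𝒜 := T.A.subtype ∘ₗ T.projA

theorem endA_apply (x : 𝒜) : T.endA x = T.projA x := rfl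

theorem endA_endA (x : 𝒜) : T.endA (T.endA x) = T.endA x := by
  rw [endA_apply, endA_apply, projA_coe]

/-- The Euler element, whose adjoint action measures the weight of a cochain. -/
noncomputable def euler : T.L := CochainSum.of 0 (linCochain T.endA)

theorem euler_mem : T.euler ∈ T.gradingL 0 := of_mem_cochainGrading (n := 0) _

/-- The elements of weight `w`, where a map from a tensor product of copies of `A` and `A'` has
weight `1` or `0`, according to whether its values are in `A` or in `A'`, minus the number of
copies of `A` in its source. -/
noncomputable def weightSpace (w : ℤ) : Submodule K T.L :=
  LinearMap.eqLocus (T.bracket T.euler) ((w : K) • LinearMap.id)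

variable {T}

theorem mem_weightSpace {w : ℤ} {x : T.L} :
    x ∈ T.weightSpace w ↔ T.bracket T.euler x = (w : K) • x := Iff.rfl

/-- The Euler element has degree 0, so bracketing with it is a derivation without signs. -/
theorem bracket_mem_weightSpace {v w : ℤ} {x y : T.L} (hx : x ∈ T.weightSpace v)
    (hy : y ∈ T.weightSpace w) : T.bracket x y ∈ T.weightSpace (v + w) := by
  have hder : ∀ x y : T.L, T.bracket T.euler (T.bracket x y) =
      T.bracket (T.bracket T.euler x) y + T.bracket x (T.bracket T.euler y) := by
    intro x y
    induction x using CochainSum.induction_on with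
    | zero => simp
    | add a b ha hb =>
      simp only [map_add, LinearMap.add_apply, ha, hb]
      abel
    | of m f =>
      induction y using CochainSum.induction_on with
      | zero => simp
      | add a b ha hb =>
        simp only [map_add, ha, hb]
        abel
      | of n g =>
        have := T.isVData.gradedLie.jacobi 0 m n _ _ _ T.euler_mem
          (of_mem_cochainGrading f) (of_mem_cochainGrading g)
        rwa [zero_mul, Int.negOnePow_zero, one_smul] at this
  rw [mem_weightSpace] at hx hy ⊢
  rw [hder, hx, hy, map_smul, map_smul, LinearMap.smul_apply, ← add_smul, Int.cast_add]

variable (T)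

theorem bracket_euler : T.bracket T.euler =
    CochainSum.desc fun n => CochainSum.of n ∘ₗ endAction T.endA n :=
  gerstenhaberBracket_linCochain T.endA

/-- On arguments in A' the projection onto A kills every input term, and it does not change the
A-component of the value. -/
theorem component_endAction {n : ℕ} (f : Cochain K 𝒜 𝒜 n) :
    T.component n (endAction T.endA n f) = T.component n f := by
  refine MultilinearMap.ext fun u => ?_
  change T.projA (endAction T.endA n f fun i => (u i : 𝒜)) = T.projA (f fun i => (u i : 𝒜))
  rw [endAction_apply, Finset.sum_eq_zero, sub_zero, endA_apply, projA_coe]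
  intro i _
  refine f.map_coord_zero i ?_
  rw [Function.update_self, endA_apply, projA_coe', ZeroMemClass.coe_zero]

theorem P_bracket_euler (x : T.L) : T.P (T.bracket T.euler x) = T.P x := by
  suffices h : T.P ∘ₗ T.bracket T.euler = T.P from LinearMap.congr_fun h x
  refine CochainSum.hom_ext fun n f => ?_
  rw [LinearMap.comp_apply, bracket_euler, CochainSum.desc_of, LinearMap.comp_apply, P_of,
    component_endAction, P_of]

theorem endAction_lift {n : ℕ} (f : Cochain K T.A' T.A n) :
    endAction T.endA n (T.lift n f) = T.lift n f := by
  refine MultilinearMap.ext fun x => ?_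
  have h : ∀ y : Fin (n + 1) → 𝒜, T.lift n f y = (f fun i => T.projA' (y i) : T.A) := fun _ => rfl
  rw [endAction_apply, Finset.sum_eq_zero, sub_zero, h, endA_apply, projA_coe]
  intro i _
  rw [h, f.map_coord_zero i, ZeroMemClass.coe_zero]
  rw [Function.update_self, endA_apply, projA'_coe']

variable {T}

theorem mem_weightSpace_of_mem_F {x : T.L} (hx : x ∈ T.F) : x ∈ T.weightSpace 1 := by
  obtain ⟨c, rfl⟩ := hx
  induction c using CochainSum.induction_on with
  | zero => rw [map_zero]; exact zero_mem _
  | add a b ha hb => rw [map_add]; exact add_mem ha hb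
  | of n f =>
    rw [mem_weightSpace, liftSum_of, bracket_euler, CochainSum.desc_of, LinearMap.comp_apply,
      endAction_lift, Int.cast_one, one_smul]

theorem iteratedBracket_mem_weightSpace {w : ℤ} {a : T.L} (ha : a ∈ T.weightSpace w) (k : ℕ)
    (x : Fin k → T.L) (hx : ∀ i, x i ∈ T.F) :
    iteratedBracket T.bracket a k x ∈ T.weightSpace (w + k) := by
  induction k with
  | zero => rwa [iteratedBracket_zero, Nat.cast_zero, add_zero]
  | succ k ih =>
    rw [iteratedBracket_succ, Nat.cast_succ, ← add_assoc]
    exact bracket_mem_weightSpace (ih _ fun i => hx _) (mem_weightSpace_of_mem_F (hx _))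

/-- Bracketing with the Euler element is invisible to P, so (w - 1) P x = 0; characteristic 0 makes
w - 1 invertible. -/
theorem P_eq_zero_of_mem_weightSpace [CharZero K] {w : ℤ} (hw : w ≠ 1) {x : T.L}
    (hx : x ∈ T.weightSpace w) :
    T.P x = 0 := by
  have h := T.P_bracket_euler x
  rw [mem_weightSpace.mp hx, map_smul] at h
  have h' : ((w : K) - 1) • T.P x = 0 := by rw [sub_smul, one_smul, h, sub_self]
  refine (smul_eq_zero.mp h').resolve_left (sub_ne_zero.mpr ?_)
  exact_mod_cast hw

theorem lift_component_of_endAction_eq [CharZero K] {n : ℕ} {f : Cochain K 𝒜 𝒜 n}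
    (hf : endAction T.endA n f = f) : T.lift n (T.component n f) = f := by
  -- On pure arguments, with `S` the positions taken from A, the input terms contribute |S| copies
  -- of the value, so weight 1 makes the value an eigenvector with eigenvalue |S| + 1.
  have key : ∀ (S : Finset (Fin (n + 1))) (x : Fin (n + 1) → 𝒜),
      T.endA (f (S.piecewise (fun i => T.projA (x i)) fun i => T.projA' (x i))) =
        ((S.card : K) + 1) • f (S.piecewise (fun i => T.projA (x i)) fun i => T.projA' (x i)) := by
    intro S x
    set y : Fin (n + 1) → 𝒜 := S.piecewise (fun i => T.projA (x i)) fun i => T.projA' (x i)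
    have h₁ := MultilinearMap.congr_fun hf y
    rw [endAction_apply, sub_eq_iff_eq_add] at h₁
    have h₂ : ∀ i, f (Function.update y i (T.endA (y i))) = if i ∈ S then f y else 0 := by
      intro i
      split_ifs with hi
      · have : T.endA (y i) = y i := by
          simp only [y, Finset.piecewise_eq_of_mem _ _ _ hi, endA_apply, projA_coe]
        rw [this, Function.update_eq_self]
      · refine f.map_coord_zero i ?_
        rw [Function.update_self]
        simp only [y, Finset.piecewise_eq_of_notMem _ _ _ hi, endA_apply, projA_coe',
          ZeroMemClass.coe_zero]
    rw [h₁, Finset.sum_congr rfl fun i _ => h₂ i, Finset.sum_ite_mem, Finset.univ_inter,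
      Finset.sum_const, add_smul, one_smul, Nat.cast_smul_eq_nsmul, add_comm]
  refine MultilinearMap.ext fun x => ?_
  have hx : x = (fun i => (T.projA (x i) : 𝒜)) + fun i => (T.projA' (x i) : 𝒜) :=
    funext fun i => (T.projA_add_projA' (x i)).symm
  conv_rhs => rw [hx, MultilinearMap.map_add_univ]
  rw [Finset.sum_eq_single ∅]
  · have := key ∅ x
    rw [Finset.card_empty, Nat.cast_zero, zero_add, one_smul, Finset.piecewise_empty] at this
    rw [Finset.piecewise_empty, ← this]
    rfl
  -- Since `endA` is idempotent, the eigenvalue |S| + 1 forces |S|(|S| + 1) to annihilate the value,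
  -- which is therefore zero unless S is empty. For S = ∅ the value lies in A.
  · intro S _ hS
    have h₁ := key S x
    have h₂ := T.endA_endA (f (S.piecewise (fun i => T.projA (x i)) fun i => T.projA' (x i)))
    rw [h₁, map_smul, h₁, smul_smul, ← sub_eq_zero, ← sub_smul] at h₂
    refine (smul_eq_zero.mp h₂).resolve_left ?_
    have h₃ : (S.card : K) ≠ 0 := by
      simpa using hS
    have h₄ : (S.card : K) + 1 ≠ 0 := Nat.cast_add_one_ne_zero _
    intro h
    refine mul_ne_zero h₃ h₄ ?_
    linear_combination h
  · simp

theorem P_of_mem_weightSpace_one [CharZero K] {x : T.L} (hx : x ∈ T.weightSpace 1) : T.P x = x := by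
  refine CochainSum.ext_coeff fun n => ?_
  rw [P_eq_desc, CochainSum.coeff_desc_of_comp]
  refine lift_component_of_endAction_eq ?_
  rw [mem_weightSpace, Int.cast_one, one_smul, bracket_euler] at hx
  rw [← CochainSum.coeff_desc_of_comp (fun n => endAction T.endA n), hx]

variable (T)

theorem bilinCochain_mem_weightSpace {φ : 𝒜 →ₗ[K] 𝒜 →ₗ[K] 𝒜} {w : ℤ}
    (h : ∀ x y, T.endA (φ x y) - φ (T.endA x) y - φ x (T.endA y) = (w : K) • φ x y) :
    (bilinCochain φ : T.L) ∈ T.weightSpace w := by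
  -- Reversing the bracket gives access to the explicit formula for a bilinear map bracketed with an
  -- endomorphism.
  have ha := T.isVData.gradedLie.antisymm 0 1 T.euler (bilinCochain φ) T.euler_mem
    (bilinCochain_mem φ)
  rw [zero_mul, Int.negOnePow_zero, one_smul, bracket, euler,
    gerstenhaberBracket_bilinCochain_linCochain, ← neg_one_smul K, ← bilinCochain_smul] at ha
  rw [mem_weightSpace, bracket, euler, ha, ← bilinCochain_smul]
  congr 1
  refine LinearMap.ext₂ fun x y => ?_
  rw [LinearMap.smul_apply, LinearMap.smul_apply, bilinBracket_apply, neg_one_smul,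
    LinearMap.smul_apply, LinearMap.smul_apply, ← h]
  abel

theorem weight_zero_mem : T.ξL + T.ηL + T.βL ∈ T.weightSpace 0 := by
  refine add_mem (add_mem ?_ ?_) ?_ <;>
    exact T.bilinCochain_mem_weightSpace fun x y => by simp [endA_apply]

theorem weight_neg_one_mem : T.πL + T.ρL + T.μL ∈ T.weightSpace (-1) := by
  refine add_mem (add_mem ?_ ?_) ?_ <;>
    exact T.bilinCochain_mem_weightSpace fun x y => by simp [endA_apply]

theorem weight_neg_two_mem : T.θL ∈ T.weightSpace (-2) :=
  T.bilinCochain_mem_weightSpace fun x y => by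
    simp [endA_apply, two_smul, sub_eq_add_neg]

theorem coe_l (k : ℕ) (x : Fin k → T.F) :
    (T.l k x : T.L) = T.P (iteratedBracket T.bracket T.Ω k fun i => (x i : T.L)) := rfl

theorem coe_l_eq (k : ℕ) (x : Fin k → T.F) :
    (T.l k x : T.L) =
      T.P (iteratedBracket T.bracket (T.ξL + T.ηL + T.βL) k fun i => (x i : T.L)) +
      T.P (iteratedBracket T.bracket (T.πL + T.ρL + T.μL) k fun i => (x i : T.L)) +
      T.P (iteratedBracket T.bracket T.θL k fun i => (x i : T.L)) := by
  rw [coe_l, ← map_add, ← map_add, ← iteratedBracket_add, ← iteratedBracket_add, Ω_eq]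
  congr 3
  abel

theorem isLInfinity [CharZero K] : IsLInfinity (V := T.F) T.gradingF T.l where
  toIsCurvedLInfinity := T.isVData.toIsCurvedVData.isCurvedLInfinity T.P_mem_gradingL T.P_mem
  curvature_eq_zero := MultilinearMap.ext fun _ => Subtype.ext T.P_Ω

theorem l_one [CharZero K] (f : T.F) : (T.l 1 ![f] : T.L) = T.bracket (T.ξL + T.ηL + T.βL) f := by
  have h₀ := iteratedBracket_mem_weightSpace T.weight_zero_mem 1 (fun i => (![f] i : T.L))
    fun i => (![f] i).2
  have h₁ := iteratedBracket_mem_weightSpace T.weight_neg_one_mem 1 (fun i => (![f] i : T.L))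
    fun i => (![f] i).2
  have h₂ := iteratedBracket_mem_weightSpace T.weight_neg_two_mem 1 (fun i => (![f] i : T.L))
    fun i => (![f] i).2
  rw [coe_l_eq, P_of_mem_weightSpace_one h₀, P_eq_zero_of_mem_weightSpace (by norm_num) h₁,
    P_eq_zero_of_mem_weightSpace (by norm_num) h₂, add_zero, add_zero]
  rfl

theorem l_two [CharZero K] (f₁ f₂ : T.F) : (T.l 2 ![f₁, f₂] : T.L) =
    T.bracket (T.bracket (T.πL + T.ρL + T.μL) f₁) f₂ := by
  have h₀ := iteratedBracket_mem_weightSpace T.weight_zero_mem 2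
    (fun i => (![f₁, f₂] i : T.L)) fun i => (![f₁, f₂] i).2
  have h₁ := iteratedBracket_mem_weightSpace T.weight_neg_one_mem 2
    (fun i => (![f₁, f₂] i : T.L)) fun i => (![f₁, f₂] i).2
  have h₂ := iteratedBracket_mem_weightSpace T.weight_neg_two_mem 2
    (fun i => (![f₁, f₂] i : T.L)) fun i => (![f₁, f₂] i).2
  rw [coe_l_eq, P_of_mem_weightSpace_one h₁, P_eq_zero_of_mem_weightSpace (by norm_num) h₀,
    P_eq_zero_of_mem_weightSpace (by norm_num) h₂, add_zero, zero_add]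
  rfl

theorem l_three [CharZero K] (f₁ f₂ f₃ : T.F) : (T.l 3 ![f₁, f₂, f₃] : T.L) =
    T.bracket (T.bracket (T.bracket T.θL f₁) f₂) f₃ := by
  have h₀ := iteratedBracket_mem_weightSpace T.weight_zero_mem 3
    (fun i => (![f₁, f₂, f₃] i : T.L)) fun i => (![f₁, f₂, f₃] i).2
  have h₁ := iteratedBracket_mem_weightSpace T.weight_neg_one_mem 3
    (fun i => (![f₁, f₂, f₃] i : T.L)) fun i => (![f₁, f₂, f₃] i).2
  have h₂ := iteratedBracket_mem_weightSpace T.weight_neg_two_mem 3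
    (fun i => (![f₁, f₂, f₃] i : T.L)) fun i => (![f₁, f₂, f₃] i).2
  rw [coe_l_eq, P_of_mem_weightSpace_one h₂, P_eq_zero_of_mem_weightSpace (by norm_num) h₀,
    P_eq_zero_of_mem_weightSpace (by norm_num) h₁, zero_add, zero_add]
  rfl

theorem l_eq_zero [CharZero K] {k : ℕ} (hk : 4 ≤ k) : T.l k = 0 := by
  refine MultilinearMap.ext fun x => Subtype.ext ?_
  have h : ∀ i, (x i : T.L) ∈ T.F := fun i => (x i).2
  rw [coe_l_eq,
    P_eq_zero_of_mem_weightSpace (by omega)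
      (iteratedBracket_mem_weightSpace T.weight_zero_mem k _ h),
    P_eq_zero_of_mem_weightSpace (by omega)
      (iteratedBracket_mem_weightSpace T.weight_neg_one_mem k _ h),
    P_eq_zero_of_mem_weightSpace (by omega)
      (iteratedBracket_mem_weightSpace T.weight_neg_two_mem k _ h), add_zero, add_zero]
  rfl

/-! ### The Maurer-Cartan equation -/

theorem P_bilinCochain_eq_zero_iff {φ : 𝒜 →ₗ[K] 𝒜 →ₗ[K] 𝒜} :
    T.P (bilinCochain φ) = 0 ↔ ∀ u v : T.A', T.projA (φ u v) = 0 := by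
  rw [bilinCochain, P_of, map_eq_zero_iff _ (CochainSum.of_injective 1),
    map_eq_zero_iff _ (Function.LeftInverse.injective (g := T.component 1) T.component_lift)]
  constructor
  · intro h u v
    exact MultilinearMap.congr_fun h ![u, v]
  · exact fun h => MultilinearMap.ext fun u => h (u 0) (u 1)

/-- A map `A' → A`, as an endomorphism of `𝒜`. -/
noncomputable def endOfMap (B : T.A' →ₗ[K] T.A) : 𝒜 →ₗ[K] 𝒜 := T.A.subtype ∘ₗ B ∘ₗ T.projA'

theorem isLeftDeformationMap_iff [CharZero K] (B : T.A' →ₗ[K] T.A) :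
    T.IsLeftDeformationMap B ↔ IsMaurerCartan (V := T.F) T.gradingF T.l (T.ofMap B) := by
  have hB : (T.ofMap B : T.L) = CochainSum.of 0 (linCochain (T.endOfMap B)) := T.liftSum_of 0 _
  have hdeg : T.ofMap B ∈ T.gradingF 0 := by
    change (T.ofMap B : T.L) ∈ T.gradingL 0
    rw [hB]
    exact of_mem_cochainGrading (n := 0) _
  have hfin : ∀ k : ℕ, (k.factorial : K)⁻¹ • T.l k (fun _ => T.ofMap B) ≠ 0 → k < 4 := by
    intro k hk
    by_contra h
    exact hk (by rw [T.l_eq_zero (not_lt.mp h)]; simp)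
  have hsum : ∑ᶠ k : ℕ, (k.factorial : K)⁻¹ • T.l k (fun _ => T.ofMap B) =
      ∑ k ∈ Finset.range 4, (k.factorial : K)⁻¹ • T.l k (fun _ => T.ofMap B) :=
    finsum_eq_sum_of_support_subset _ fun k hk => by
      simpa using hfin k hk
  have hbr : ∀ φ : 𝒜 →ₗ[K] 𝒜 →ₗ[K] 𝒜, T.bracket (bilinCochain φ) (T.ofMap B : T.L) =
      bilinCochain (bilinBracket φ (T.endOfMap B)) := fun φ => by
    rw [hB]
    exact gerstenhaberBracket_bilinCochain_linCochain φ _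
  let t := T.endOfMap B
  let m := LinearMap.mul K 𝒜
  -- The coefficients are 1/k! for k = 1, 2, 3; the term k = 0 vanishes by `P_Ω` and those with k ≥
  -- 4 by weight.
  let ψ : 𝒜 →ₗ[K] 𝒜 →ₗ[K] 𝒜 := bilinBracket m t + (2 : K)⁻¹ • bilinBracket (bilinBracket m t) t +
    (6 : K)⁻¹ • bilinBracket (bilinBracket (bilinBracket m t) t) t
  have hval : ((∑ k ∈ Finset.range 4, (k.factorial : K)⁻¹ • T.l k (fun _ => T.ofMap B) : T.F) :
      T.L) = T.P (bilinCochain ψ) := by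
    have h₀ : (T.l 0 fun _ => T.ofMap B) = 0 := Subtype.ext T.P_Ω
    have h₁ : ((T.l 1 fun _ => T.ofMap B : T.F) : T.L) = T.P (bilinCochain (bilinBracket m t)) := by
      rw [coe_l, iteratedBracket_succ, iteratedBracket_zero, Ω, hbr]
    have h₂ : ((T.l 2 fun _ => T.ofMap B : T.F) : T.L) =
        T.P (bilinCochain (bilinBracket (bilinBracket m t) t)) := by
      rw [coe_l, iteratedBracket_succ, iteratedBracket_succ, iteratedBracket_zero, Ω, hbr, hbr]
    have h₃ : ((T.l 3 fun _ => T.ofMap B : T.F) : T.L) =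
        T.P (bilinCochain (bilinBracket (bilinBracket (bilinBracket m t) t) t)) := by
      rw [coe_l, iteratedBracket_succ, iteratedBracket_succ, iteratedBracket_succ,
        iteratedBracket_zero, Ω, hbr, hbr, hbr]
    simp only [Finset.sum_range_succ, Finset.sum_range_zero, h₀, smul_zero, zero_add,
      Submodule.coe_add, Submodule.coe_smul, h₁, h₂, h₃, ψ, bilinCochain_add, bilinCochain_smul,
      map_add, map_smul]
    norm_num [Nat.factorial]
  have htt : ∀ x, t (t x) = 0 := fun x => by
    simp [t, endOfMap]
  -- Let L, R, T apply t to the first input, the second input and the output. They commute and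
  -- square to zero, so the truncated exponential of L + R - T, minus 1, is (1 + L)(1 + R)(1 - T) -
  -- 1.
  have hψ : ∀ x y, ψ x y = t x * y + x * t y + t x * t y -
      t (x * y + t x * y + x * t y + t x * t y) := by
    intro x y
    simp only [ψ, m, LinearMap.add_apply, LinearMap.smul_apply, bilinBracket_apply,
      LinearMap.mul_apply', htt, map_add, map_sub, map_zero,
      LinearMap.zero_apply]
    module
  have hiff : T.IsLeftDeformationMap B ↔ ∀ u v : T.A', T.projA (ψ u v) = 0 := by
    refine forall₂_congr fun u v => ?_
    have ht : ∀ x : 𝒜, t x = B (T.projA' x) := fun _ => rfl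
    -- As t factors through the projection to A', the term t(⋯) yields B of β, ρ, μ, θ, while the
    -- remaining terms yield ξ, η, π.
    rw [hψ, map_sub, ht (_ + _), projA_coe, sub_eq_zero]
    simp only [map_add, ht, projA'_coe, π, ξ, η, β, ρ, μ, θ, LinearMap.compr₂_apply,
      LinearMap.compl₁₂_apply, LinearMap.mul_apply', Submodule.subtype_apply]
    rw [show ∀ a b c : T.A, a + b + c = b + c + a from fun a b c => by abel]
  rw [hiff, ← P_bilinCochain_eq_zero_iff, ← hval, ZeroMemClass.coe_eq_zero, ← hsum]
  exact ⟨fun h => ⟨hdeg, (Set.finite_lt_nat 4).subset hfin, h⟩, fun h => h.equation⟩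

end QuasiTwilledAlgebra

theorem theorem4 {K 𝒜 : Type*} [Field K] [CharZero K] [NonUnitalRing 𝒜] [Module K 𝒜]
    [IsScalarTower K 𝒜 𝒜] [SMulCommClass K 𝒜 𝒜] (T : QuasiTwilledAlgebra K 𝒜) :
    T.Ω = T.πL + T.ξL + T.ηL + T.βL + T.ρL + T.μL + T.θL ∧
    IsVData T.gradingL T.bracket T.F T.P T.Ω ∧
    IsLInfinity (V := T.F) T.gradingF T.l ∧
    (∀ f : T.F, (T.l 1 ![f] : T.L) = T.bracket (T.ξL + T.ηL + T.βL) f) ∧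
    (∀ f₁ f₂ : T.F, (T.l 2 ![f₁, f₂] : T.L) =
      T.bracket (T.bracket (T.πL + T.ρL + T.μL) f₁) f₂) ∧
    (∀ f₁ f₂ f₃ : T.F, (T.l 3 ![f₁, f₂, f₃] : T.L) =
      T.bracket (T.bracket (T.bracket T.θL f₁) f₂) f₃) ∧
    (∀ k : ℕ, 4 ≤ k → T.l k = 0) ∧
    (∀ B : T.A' →ₗ[K] T.A,
      T.IsLeftDeformationMap B ↔ IsMaurerCartan (V := T.F) T.gradingF T.l (T.ofMap B)) := by
  exact ⟨T.Ω_eq, T.isVData, T.isLInfinity, T.l_one, T.l_two, T.l_three,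
    fun _ hk => T.l_eq_zero hk, T.isLeftDeformationMap_iff⟩
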